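/- Consider real solutions of the first Painlevé equation $y''=6y^2-x$, each taken on its interval of existence, i.e. the largest open interval $I\subseteq\mathbb R$ to which it extends as a real (pole-free) solution; solutions with different intervals of existence are considered different. A number $x_0$ is the right pole of a solution if it is the right endpoint of $I$ and the solution has a pole at $x_0$. For $x_0\le 0$ and $y_0>y_l$ let $x_{min}(x_0,y_0,y_l)<x_0$ denote the point at which the solution $y$ that is regular at $x_0$, satisfies $y(x_0)=y_0$, and has $y_l$ as its minimum value over $I\cap(-\infty,x_0]$, attains this minimum. Put $$\mathcal X_{min}(x_0,y_l)=\inf_{y_0>y_l}x_{min}(x_0,y_0,y_l).$$ **Theorem 3.1.** Every solution whose interval of existence is contained in $(-\infty,0]$ has a right pole $x_0\le 0$ and attains a minimum value $y_l\in\mathbb R$ on its interval of existence, and it is uniquely determined by the pair $(x_0,y_l)$: for every $x_0\le0$ and every $y_l\in\mathbb R$ there is exactly one solution with interval of existence contained in $(-\infty,0]$, right pole $x_0$ and minimum value $y_l$. Moreover, $\mathcal X_{min}(x_0,y_l)$ is finite, and this solution attains its minimum value at $\mathcal X_{min}(x_0,y_l)$ and nowhere else. -/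

import Mathlib

open Set Filter Topology

/-- `y` satisfies the first Painlevé equation `y'' = 6 y² - x` at every point of the open set `I`
(it is twice differentiable there). Values of `y` outside `I` are irrelevant. -/
def SolvesP1On (I : Set ℝ) (y : ℝ → ℝ) : Prop :=
  ∀ x ∈ I, DifferentiableAt ℝ y x ∧ HasDerivAt (deriv y) (6 * y x ^ 2 - x) x

/-- A real solution of the first Painlevé equation together with its interval of existence `I`:
a nonempty open interval on which `y` solves the equation, and to no larger open interval can
`y` be continued as a solution. -/
structure IsP1Solution (I : Set ℝ) (y : ℝ → ℝ) : Prop where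
  isOpen : IsOpen I
  isConnected : IsConnected I
  solves : SolvesP1On I y
  maximal : ∀ (J : Set ℝ) (z : ℝ → ℝ), IsOpen J → IsConnected J → I ⊆ J →
    SolvesP1On J z → EqOn y z I → J = I

/-- `x₀` is the right pole of the solution `y` with interval of existence `I`: it is the right
endpoint of `I`, and to the left of `x₀` the function `y` agrees with a (real) meromorphic
germ at `x₀` that has a pole at `x₀`. -/
def IsRightPole (I : Set ℝ) (y : ℝ → ℝ) (x₀ : ℝ) : Prop :=
  IsLUB I x₀ ∧ ∃ g : ℝ → ℝ, MeromorphicAt g x₀ ∧ meromorphicOrderAt g x₀ < 0 ∧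
    y =ᶠ[𝓝[<] x₀] g

/-- `m` is a value of `x_min(x₀, y₀, y_l)`: some solution regular at `x₀` has the value `y₀` at
`x₀`, and its minimum to the left of `x₀` has the value `y_l` and is attained at `m < x₀`. -/
def IsXmin (x₀ y₀ yl m : ℝ) : Prop :=
  ∃ (I : Set ℝ) (y : ℝ → ℝ), IsP1Solution I y ∧ x₀ ∈ I ∧ y x₀ = y₀ ∧
    m ∈ I ∧ m < x₀ ∧ y m = yl ∧ ∀ x ∈ I, x ≤ x₀ → yl ≤ y x

/-- All values `x_min(x₀, y₀, y_l)` with `y₀ > y_l`. -/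
def xminValues (x₀ yl : ℝ) : Set ℝ := {m | ∃ y₀ > yl, IsXmin x₀ y₀ yl m}

/-- `𝒳_min(x₀, y_l) = inf_{y₀ > y_l} x_min(x₀, y₀, y_l)`. -/
noncomputable def calXmin (x₀ yl : ℝ) : ℝ := sInf (xminValues x₀ yl)

/-! For `x < 0` the equation gives `y'' = 6y² - x > 0`, so every solution is strictly convex on the
nonpositive half-line and a critical point there is its only minimum. A solution can stop only where
`(y, y')` is unbounded. Convexity then forces `y → +∞` at a right end `b ≤ 0`. Superlinear growth
prevents a solution from reaching `-∞`, and at the finite left end `y'` cannot have stayed positive.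
Hence a solution living in `(-∞, 0]` has a critical point `m`, and it is the solution with data
`(y_l, 0)` at `m`. The theorem thus becomes a statement about how its right end `b` depends on `m`
for fixed `y_l`.

Uniqueness is monotonicity of `b`. Shift two solutions with minima at `m₁ < m₂` to a common starting
time. The first one starts with the larger second derivative, and the energy `v²/2 - 2u³ + (m +
t)u`, whose derivative is `u`, shows that they never cross again (`IsP1Solution.comparison`). So the
first blows up after no longer a time, and `b` is strictly increasing in `m`
(`IsP1Solution.not_mem_of_lt`). The same comparison shows that the solutions with minimum value
`y_l` to the left of `b` that are regular at `b` are those with minimum in `(m, b)`, whence `𝒳_min =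
m` (`IsP1Solution.xminValues_eq`).

Existence is a supremum argument in `m`: being regular at `x₀` is an open condition by
`IsP1Solution.continuous_dependence`, and blowing up strictly before `x₀` persists under small
shifts of `m` by the explicit estimate `lifespan_lt`.

That the blow-up is a pole is shown by Painlevé's regularization `y = u⁻²`. The energy is `O(y)`
near `b`, which yields a limit of the second coordinate `v`; the regularized field is polynomial, so
`u` continues analytically through `b` with value `0`. -/

/-! ### The first-order system and uniqueness -/

/-- The first Painlevé equation as a first-order system for `(y, y')`. -/
def p1Field (x : ℝ) (Y : ℝ × ℝ) : ℝ × ℝ := (Y.2, 6 * Y.1 ^ 2 - x)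

/-- The curve `(y, y')` in the phase plane. -/
noncomputable def phase (y : ℝ → ℝ) (x : ℝ) : ℝ × ℝ := (y x, deriv y x)

lemma p1Field_lipschitzOnWith (R : NNReal) (x : ℝ) :
    LipschitzOnWith (12 * R + 1) (p1Field x) {Y | |Y.1| ≤ R} := by
  refine LipschitzOnWith.of_dist_le_mul fun Y hY Z hZ => ?_
  simp only [mem_ofPred_eq] at hY hZ
  have h1 : |Y.1 - Z.1| ≤ dist Y Z := by
    rw [Prod.dist_eq, Real.dist_eq]; exact le_max_left _ _
  have h2 : |Y.2 - Z.2| ≤ dist Y Z := by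
    rw [Prod.dist_eq, Real.dist_eq (x := Y.2)]; exact le_max_right _ _
  have hR : (0 : ℝ) ≤ R := R.2
  have hd : 0 ≤ dist Y Z := dist_nonneg
  rw [Prod.dist_eq, Real.dist_eq, Real.dist_eq]
  push_cast
  refine max_le ?_ ?_
  · simp only [p1Field]
    nlinarith [mul_nonneg hR hd]
  · have h3 : |Y.1 + Z.1| ≤ 2 * R := (abs_add_le _ _).trans (by linarith)
    have : (p1Field x Y).2 - (p1Field x Z).2 = 6 * ((Y.1 + Z.1) * (Y.1 - Z.1)) := by
      simp only [p1Field]; ring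
    rw [this, abs_mul, abs_mul, abs_of_pos (by norm_num : (0 : ℝ) < 6)]
    have : |Y.1 + Z.1| * |Y.1 - Z.1| ≤ 2 * R * dist Y Z := by gcongr
    nlinarith

lemma SolvesP1On.mono {I J : Set ℝ} {y : ℝ → ℝ} (h : SolvesP1On I y) (hJ : J ⊆ I) :
    SolvesP1On J y := fun x hx => h x (hJ hx)

lemma SolvesP1On.hasDerivAt {I : Set ℝ} {y : ℝ → ℝ} (h : SolvesP1On I y) {x : ℝ} (hx : x ∈ I) :
    HasDerivAt y (deriv y x) x := (h x hx).1.hasDerivAt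

lemma SolvesP1On.hasDerivAt_phase {I : Set ℝ} {y : ℝ → ℝ} (h : SolvesP1On I y) {x : ℝ}
    (hx : x ∈ I) : HasDerivAt (phase y) (p1Field x (phase y x)) x :=
  (h.hasDerivAt hx).prodMk (h x hx).2

lemma SolvesP1On.continuousOn_phase {I : Set ℝ} {y : ℝ → ℝ} (h : SolvesP1On I y) :
    ContinuousOn (phase y) I :=
  fun _ hx => (h.hasDerivAt_phase hx).continuousAt.continuousWithinAt

lemma SolvesP1On.continuousOn {I : Set ℝ} {y : ℝ → ℝ} (h : SolvesP1On I y) :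
    ContinuousOn y I :=
  fun _ hx => (h.hasDerivAt hx).continuousAt.continuousWithinAt

lemma SolvesP1On.continuousOn_deriv {I : Set ℝ} {y : ℝ → ℝ} (h : SolvesP1On I y) :
    ContinuousOn (deriv y) I :=
  fun x hx => (h x hx).2.continuousAt.continuousWithinAt

lemma SolvesP1On.congr {I : Set ℝ} (hI : IsOpen I) {y z : ℝ → ℝ} (h : SolvesP1On I y)
    (hyz : EqOn z y I) : SolvesP1On I z := by
  intro x hx
  have h1 : z =ᶠ[𝓝 x] y := hyz.eventuallyEq_of_mem (hI.mem_nhds hx)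
  refine ⟨h1.differentiableAt_iff.2 (h x hx).1, ?_⟩
  rw [h1.eq_of_nhds]
  exact (h x hx).2.congr_of_eventuallyEq h1.deriv

lemma phase_eq_of_eqOn {I : Set ℝ} (hI : IsOpen I) {y z : ℝ → ℝ} (hyz : EqOn z y I) {x : ℝ}
    (hx : x ∈ I) : phase z x = phase y x := by
  have h1 : z =ᶠ[𝓝 x] y := hyz.eventuallyEq_of_mem (hI.mem_nhds hx)
  exact Prod.ext h1.eq_of_nhds h1.deriv_eq

lemma solvesP1On_of_curve {I : Set ℝ} (hI : IsOpen I) {α : ℝ → ℝ × ℝ}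
    (h : ∀ t ∈ I, HasDerivAt α (p1Field t (α t)) t) :
    SolvesP1On I (fun t => (α t).1) ∧ ∀ t ∈ I, phase (fun t => (α t).1) t = α t := by
  have h1 : ∀ t ∈ I, HasDerivAt (fun t => (α t).1) (α t).2 t := fun t ht => (h t ht).fst
  have h2 : ∀ t ∈ I, HasDerivAt (fun t => (α t).2) (6 * (α t).1 ^ 2 - t) t :=
    fun t ht => (h t ht).snd
  refine ⟨fun t ht => ⟨(h1 t ht).differentiableAt, ?_⟩, fun t ht => ?_⟩
  · refine (h2 t ht).congr_of_eventuallyEq ?_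
    filter_upwards [hI.mem_nhds ht] with s hs using (h1 s hs).deriv
  · exact Prod.ext rfl (h1 t ht).deriv

lemma SolvesP1On.phase_eventuallyEq {I : Set ℝ} (hI : IsOpen I) {y z : ℝ → ℝ}
    (hy : SolvesP1On I y) (hz : SolvesP1On I z) {x : ℝ} (hx : x ∈ I)
    (h : phase y x = phase z x) : phase y =ᶠ[𝓝 x] phase z := by
  -- The field is only locally Lipschitz; the margin `1` keeps both curves in the strip `|Y.1| ≤ R`
  -- near `x`.
  set R : NNReal := ‖y x‖₊ + 1
  have key : ∀ w : ℝ → ℝ, SolvesP1On I w → phase y x = phase w x → ∀ᶠ t in 𝓝 x,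
      HasDerivAt (phase w) (p1Field t (phase w t)) t ∧ phase w t ∈ {Y : ℝ × ℝ | |Y.1| ≤ R} := by
    intro w hw hyw
    have hc : ContinuousAt (fun t => |w t|) x := (hw.hasDerivAt hx).continuousAt.abs
    have hlt : |w x| < R := by
      have : y x = w x := congrArg Prod.fst hyw
      simp [R, ← this]
    filter_upwards [hI.mem_nhds hx, hc.eventually_lt_const hlt] with t ht h't
    exact ⟨hw.hasDerivAt_phase ht, h't.le⟩
  exact ODE_solution_unique_of_eventually (s := fun _ => {Y : ℝ × ℝ | |Y.1| ≤ R})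
    (Eventually.of_forall fun t => p1Field_lipschitzOnWith R t) (key y hy rfl) (key z hz h) h

lemma SolvesP1On.eqOn_phase {I : Set ℝ} (hI : IsOpen I) (hI' : IsPreconnected I) {y z : ℝ → ℝ}
    (hy : SolvesP1On I y) (hz : SolvesP1On I z) {x : ℝ} (hx : x ∈ I)
    (h : phase y x = phase z x) : EqOn (phase y) (phase z) I := by
  set u : Set ℝ := {t | phase y =ᶠ[𝓝 t] phase z}
  have hu : IsOpen u := isOpen_setOfPred_eventually_nhds
  have hsub : I ⊆ u := by
    refine hI'.subset_of_closure_inter_subset hu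
      ⟨x, hx, hy.phase_eventuallyEq hI hz hx h⟩ fun t ⟨ht, htI⟩ => ?_
    refine hy.phase_eventuallyEq hI hz htI ?_
    have : (𝓝[u] t).NeBot := mem_closure_iff_nhdsWithin_neBot.1 ht
    have h1 : Tendsto (phase y) (𝓝[u] t) (𝓝 (phase y t)) :=
      (hy.hasDerivAt_phase htI).continuousAt.tendsto.mono_left nhdsWithin_le_nhds
    have h2 : Tendsto (phase z) (𝓝[u] t) (𝓝 (phase z t)) :=
      (hz.hasDerivAt_phase htI).continuousAt.tendsto.mono_left nhdsWithin_le_nhds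
    refine tendsto_nhds_unique_of_eventuallyEq h1 h2 ?_
    filter_upwards [self_mem_nhdsWithin] with s hs using hs.self_of_nhds
  exact fun t ht => (hsub ht).self_of_nhds

lemma SolvesP1On.eqOn_inter {I J : Set ℝ} (hI : IsOpen I) (hI' : IsPreconnected I)
    (hJ : IsOpen J) (hJ' : IsPreconnected J) {y z : ℝ → ℝ}
    (hy : SolvesP1On I y) (hz : SolvesP1On J z) {x : ℝ} (hx : x ∈ I) (hxJ : x ∈ J)
    (h : phase y x = phase z x) : EqOn y z (I ∩ J) := by
  have hc : IsPreconnected (I ∩ J) := (hI'.ordConnected.inter hJ'.ordConnected).isPreconnected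
  have := (hy.mono inter_subset_left).eqOn_phase (hI.inter hJ) hc (hz.mono inter_subset_right)
    ⟨hx, hxJ⟩ h
  exact fun t ht => congrArg Prod.fst (this ht)

/-! ### Local existence and maximal solutions -/

/-- Local existence, with an existence time that is uniform in the initial data. -/
lemma exists_local_solution (τ : ℝ) (L : ℝ × ℝ) :
    ∃ r > 0, ∃ ε > 0, ∀ (t₀ : ℝ) (Y₀ : ℝ × ℝ), dist t₀ τ ≤ r → dist Y₀ L ≤ r →
      ∃ z : ℝ → ℝ, SolvesP1On (Ioo (t₀ - ε) (t₀ + ε)) z ∧ phase z t₀ = Y₀ := by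
  -- Adjoining time as an unknown makes the system autonomous, so the existence time is uniform in
  -- `t₀` as well; `htime` then recovers the time coordinate.
  set f : ℝ × ℝ × ℝ → ℝ × ℝ × ℝ := fun X => (1, p1Field X.1 X.2)
  have hf : ContDiffAt ℝ 1 f (τ, L) := by
    unfold f p1Field; fun_prop
  obtain ⟨r, hr, ε, hε, H⟩ :=
    hf.exists_forall_mem_closedBall_exists_eq_forall_mem_Ioo_hasDerivAt 0
  refine ⟨r, hr, ε, hε, fun t₀ Y₀ ht hY => ?_⟩
  obtain ⟨α, hα0, hα⟩ := H (t₀, Y₀) (by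
    rw [Metric.mem_closedBall, Prod.dist_eq]; exact max_le ht hY)
  simp only [zero_sub, zero_add] at hα
  have htime : ∀ t ∈ Ioo (-ε) ε, (α t).1 = t₀ + t := by
    have hd : ∀ t ∈ Ioo (-ε) ε, HasDerivAt (fun t => (α t).1 - t) 0 t := fun t ht => by
      have h1 : HasDerivAt (fun t => (α t).1) 1 t := (hα t ht).fst
      simpa using h1.fun_sub (hasDerivAt_id' t)
    intro t ht
    have h0 : (0 : ℝ) ∈ Ioo (-ε) ε := ⟨by linarith, hε⟩
    have := isOpen_Ioo.is_const_of_deriv_eq_zero isPreconnected_Ioo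
      (fun s hs => (hd s hs).differentiableAt.differentiableWithinAt)
      (fun s hs => (hd s hs).deriv) ht h0
    simp only [hα0] at this
    linarith
  obtain ⟨h1, h2⟩ := solvesP1On_of_curve (I := Ioo (t₀ - ε) (t₀ + ε)) isOpen_Ioo
    (α := fun t => (α (t - t₀)).2) (fun t ht => by
      have hm : t - t₀ ∈ Ioo (-ε) ε := ⟨by linarith [ht.1], by linarith [ht.2]⟩
      have h4 := htime _ hm
      have h3 : HasDerivAt (fun t => (α t).2)
        (p1Field (α (t - t₀)).1 (α (t - t₀)).2) (t - t₀) := (hα _ hm).snd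
      rw [h4, add_sub_cancel] at h3
      exact h3.comp_sub_const t t₀)
  refine ⟨_, h1, ?_⟩
  rw [h2 t₀ ⟨by linarith, by linarith⟩]
  simp [hα0]

/-- Two solutions that agree where both are defined can be glued. -/
lemma SolvesP1On.glue {I J : Set ℝ} (hI : IsOpen I) (hJ : IsOpen J) {y z : ℝ → ℝ}
    (hy : SolvesP1On I y) (hz : SolvesP1On J z) (h : EqOn y z (I ∩ J)) :
    ∃ w, SolvesP1On (I ∪ J) w ∧ EqOn w y I ∧ EqOn w z J := by
  classical
  have h1 : EqOn (I.piecewise y z) y I := piecewise_eqOn I y z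
  have h2 : EqOn (I.piecewise y z) z J := by
    intro x hx
    by_cases hxI : x ∈ I
    · rw [h1 hxI, h ⟨hxI, hx⟩]
    · exact piecewise_eq_of_notMem I y z hxI
  refine ⟨_, ?_, h1, h2⟩
  rintro x (hx | hx)
  · exact hy.congr hI h1 x hx
  · exact hz.congr hJ h2 x hx

/-- Every initial value problem has a solution on a maximal interval. -/
lemma exists_isP1Solution (x₀ : ℝ) (Y₀ : ℝ × ℝ) :
    ∃ (I : Set ℝ) (y : ℝ → ℝ), IsP1Solution I y ∧ x₀ ∈ I ∧ phase y x₀ = Y₀ := by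
  classical
  -- The maximal solution is the union of all solutions of the initial value problem, which agree
  -- pairwise by uniqueness.
  set S : Set (Set ℝ × (ℝ → ℝ)) := {p | IsOpen p.1 ∧ IsPreconnected p.1 ∧ x₀ ∈ p.1 ∧
    SolvesP1On p.1 p.2 ∧ phase p.2 x₀ = Y₀}
  have hagree : ∀ p ∈ S, ∀ q ∈ S, EqOn p.2 q.2 (p.1 ∩ q.1) := fun p hp q hq =>
    hp.2.2.2.1.eqOn_inter hp.1 hp.2.1 hq.1 hq.2.1 hq.2.2.2.1 hp.2.2.1 hq.2.2.1
      (hp.2.2.2.2.trans hq.2.2.2.2.symm)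
  set I : Set ℝ := ⋃ p ∈ S, p.1
  have hIopen : IsOpen I := isOpen_biUnion fun p hp => hp.1
  have hIconn : IsPreconnected I := by
    have : I = ⋃₀ (Prod.fst '' S) := by simp [I, sUnion_image]
    rw [this]
    refine isPreconnected_sUnion x₀ _ ?_ ?_
    · rintro _ ⟨p, hp, rfl⟩; exact hp.2.2.1
    · rintro _ ⟨p, hp, rfl⟩; exact hp.2.1
  have hmem : ∀ x ∈ I, ∃ p ∈ S, x ∈ p.1 := fun x hx => by simpa [I] using hx
  set y : ℝ → ℝ := fun x => if h : x ∈ I then (hmem x h).choose.2 x else 0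
  have hy : ∀ p ∈ S, EqOn y p.2 p.1 := by
    intro p hp x hx
    have hxI : x ∈ I := mem_biUnion hp hx
    have hc := (hmem x hxI).choose_spec
    simp only [y, dif_pos hxI]
    exact hagree _ hc.1 _ hp ⟨hc.2, hx⟩
  have hysol : SolvesP1On I y := by
    intro x hx
    obtain ⟨p, hp, hxp⟩ := hmem x hx
    exact hp.2.2.2.1.congr hp.1 (hy p hp) x hxp
  obtain ⟨r, hr, ε, hε, H⟩ := exists_local_solution x₀ Y₀
  obtain ⟨z, hz, hz0⟩ := H x₀ Y₀ (by simpa using hr.le) (by simpa using hr.le)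
  have hx0 : x₀ ∈ Ioo (x₀ - ε) (x₀ + ε) := ⟨by linarith, by linarith⟩
  have hzS : (Ioo (x₀ - ε) (x₀ + ε), z) ∈ S := ⟨isOpen_Ioo, isPreconnected_Ioo, hx0, hz, hz0⟩
  have hx0I : x₀ ∈ I := mem_biUnion hzS hx0
  have hphase : phase y x₀ = Y₀ := (phase_eq_of_eqOn isOpen_Ioo (hy _ hzS) hx0).trans hz0
  refine ⟨I, y, ⟨hIopen, ⟨⟨x₀, hx0I⟩, hIconn⟩, hysol, ?_⟩, hx0I, hphase⟩
  intro J w hJ hJ' hIJ hw hyw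
  refine (subset_antisymm hIJ ?_).symm
  have : (J, w) ∈ S := ⟨hJ, hJ'.isPreconnected, hIJ hx0I, hw,
    (phase_eq_of_eqOn hIopen hyw hx0I).symm.trans hphase⟩
  exact subset_biUnion_of_mem (u := fun p : Set ℝ × (ℝ → ℝ) => p.1) this

lemma IsP1Solution.subset_of_phase_eq {I J : Set ℝ} {y z : ℝ → ℝ} (h : IsP1Solution I y)
    (hJ : IsOpen J) (hJ' : IsPreconnected J) (hz : SolvesP1On J z) {x : ℝ} (hx : x ∈ I)
    (hxJ : x ∈ J) (hyz : phase y x = phase z x) : J ⊆ I := by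
  obtain ⟨w, hw, hwy, -⟩ := h.solves.glue h.isOpen hJ hz
    (h.solves.eqOn_inter h.isOpen h.isConnected.isPreconnected hJ hJ' hz hx hxJ hyz)
  have := h.maximal (I ∪ J) w (h.isOpen.union hJ)
    ⟨⟨x, Or.inl hx⟩, h.isConnected.isPreconnected.union x hx hxJ hJ'⟩ subset_union_left hw hwy.symm
  rw [← this]; exact subset_union_right

lemma IsP1Solution.eq_of_phase_eq {I J : Set ℝ} {y z : ℝ → ℝ} (h : IsP1Solution I y)
    (h' : IsP1Solution J z) {x : ℝ} (hx : x ∈ I) (hxJ : x ∈ J) (hyz : phase y x = phase z x) :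
    I = J ∧ EqOn y z I := by
  have h1 : J ⊆ I := h.subset_of_phase_eq h'.isOpen h'.isConnected.isPreconnected h'.solves
    hx hxJ hyz
  have h2 : I ⊆ J := h'.subset_of_phase_eq h.isOpen h.isConnected.isPreconnected h.solves
    hxJ hx hyz.symm
  have h3 := subset_antisymm h2 h1
  subst h3
  refine ⟨rfl, ?_⟩
  simpa using h.solves.eqOn_inter h.isOpen h.isConnected.isPreconnected h.isOpen
    h.isConnected.isPreconnected h'.solves hx hx hyz

/-- A solution leaves every compact set of the phase plane at a finite end of its interval of
existence. -/
lemma IsP1Solution.not_frequently_bounded {I : Set ℝ} {y : ℝ → ℝ} (h : IsP1Solution I y)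
    {τ : ℝ} (hτ : τ ∉ I) (R : ℝ) : ¬ ∃ᶠ t in 𝓝[I] τ, ‖phase y t‖ ≤ R := by
  intro hf
  have hK : IsCompact (Metric.closedBall (0 : ℝ × ℝ) R) := isCompact_closedBall _ _
  -- Near a cluster point `L` the existence time has a positive lower bound, so a solution started
  -- close enough to `τ` passes beyond `τ`.
  obtain ⟨L, -, hL⟩ := hK.exists_mapClusterPt_of_frequently (f := phase y) (l := 𝓝[I] τ)
    (hf.mono fun t ht => by simpa using ht)
  obtain ⟨r, hr, ε, hε, H⟩ := exists_local_solution τ L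
  have h1 : ∃ᶠ t in 𝓝[I] τ, dist (phase y t) L ≤ r :=
    (hL.frequently (Metric.closedBall_mem_nhds L hr)).mono fun t ht => ht
  have h2 : ∀ᶠ t in 𝓝[I] τ, dist t τ ≤ r ∧ dist t τ < ε ∧ t ∈ I := by
    have a1 : ∀ᶠ t in 𝓝[I] τ, dist t τ ≤ r :=
      nhdsWithin_le_nhds (Metric.closedBall_mem_nhds τ hr)
    have a2 : ∀ᶠ t in 𝓝[I] τ, dist t τ < ε := nhdsWithin_le_nhds (Metric.ball_mem_nhds τ hε)
    filter_upwards [a1, a2, self_mem_nhdsWithin] with t b1 b2 b3 using ⟨b1, b2, b3⟩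
  obtain ⟨t, ht1, ht2, ht3, htI⟩ := (h1.and_eventually h2).exists
  obtain ⟨z, hz, hzt⟩ := H t (phase y t) ht2 ht1
  have htm : t ∈ Ioo (t - ε) (t + ε) := ⟨by linarith, by linarith⟩
  have := h.subset_of_phase_eq isOpen_Ioo isPreconnected_Ioo hz htI htm hzt.symm
  refine hτ (this ?_)
  rw [Real.dist_eq, abs_lt] at ht3
  exact ⟨by linarith, by linarith⟩

/-! ### Blow-up in explicit finite time -/

lemma le_of_hasDerivAt_nonneg {g g' : ℝ → ℝ} {a b : ℝ} (hab : a ≤ b)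
    (hg : ∀ t ∈ Icc a b, HasDerivAt g (g' t) t) (h : ∀ t ∈ Icc a b, 0 ≤ g' t) : g a ≤ g b :=
  monotoneOn_of_hasDerivWithinAt_nonneg (convex_Icc a b) (HasDerivAt.continuousOn hg)
    (fun t ht => (hg t (interior_subset ht)).hasDerivWithinAt)
    (fun t ht => h t (interior_subset ht)) (left_mem_Icc.2 hab) (right_mem_Icc.2 hab) hab

lemma lt_of_hasDerivAt_pos {g g' : ℝ → ℝ} {a b : ℝ} (hab : a < b)
    (hg : ∀ t ∈ Icc a b, HasDerivAt g (g' t) t) (h : ∀ t ∈ Ioo a b, 0 < g' t) : g a < g b :=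
  strictMonoOn_of_hasDerivWithinAt_pos (convex_Icc a b) (HasDerivAt.continuousOn hg)
    (fun t ht => (hg t (interior_subset ht)).hasDerivWithinAt)
    (fun t ht => h t (by rwa [interior_Icc] at ht)) (left_mem_Icc.2 hab.le)
    (right_mem_Icc.2 hab.le) hab

/-- An explicit bound for the lifespan of a growing solution of `z'' ≥ 6 z²`. -/
lemma lifespan_lt {z z' f : ℝ → ℝ} {p h : ℝ} (hh : 0 ≤ h)
    (hz : ∀ t ∈ Icc p (p + h), HasDerivAt z (z' t) t)
    (hz' : ∀ t ∈ Icc p (p + h), HasDerivAt z' (f t) t)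
    (hf : ∀ t ∈ Icc p (p + h), 6 * z t ^ 2 ≤ f t)
    (hp : 0 < z p) (hp' : 0 < z' p) (hE : z p ^ 3 ≤ z' p ^ 2) : h < 2 * (√(z p))⁻¹ := by
  have sub : ∀ {t}, t ∈ Icc p (p + h) → Icc p t ⊆ Icc p (p + h) := fun ht =>
    Icc_subset_Icc_right ht.2
  have h1 : ∀ t ∈ Icc p (p + h), 0 < z' t := fun t ht =>
    hp'.trans_le (le_of_hasDerivAt_nonneg ht.1 (fun s hs => hz' s (sub ht hs))
      fun s hs => (by positivity : 0 ≤ 6 * z s ^ 2).trans (hf s (sub ht hs)))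
  have h2 : ∀ t ∈ Icc p (p + h), 0 < z t := fun t ht =>
    hp.trans_le (le_of_hasDerivAt_nonneg ht.1 (fun s hs => hz s (sub ht hs))
      fun s hs => (h1 s (sub ht hs)).le)
  have h3 : ∀ t ∈ Icc p (p + h), z t ^ 3 ≤ z' t ^ 2 := by
    intro t ht
    have := le_of_hasDerivAt_nonneg (g := fun t => z' t ^ 2 - z t ^ 3)
      (g' := fun t => 2 * z' t * f t - 3 * z t ^ 2 * z' t) ht.1
      (fun s hs => by
        simpa using ((hz' s (sub ht hs)).fun_pow 2).fun_sub ((hz s (sub ht hs)).fun_pow 3))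
      (fun s hs => by
        have a := h1 s (sub ht hs)
        have b := hf s (sub ht hs)
        have : 0 ≤ z' s * (2 * f s - 3 * z s ^ 2) :=
          mul_nonneg a.le (by nlinarith [sq_nonneg (z s)])
        linarith)
    linarith
  -- From `z' ≥ z^(3/2)` it follows that `-z^(-1/2)` grows at rate at least `1/2`, yet it stays
  -- negative.
  have h4 := le_of_hasDerivAt_nonneg (g := fun t => -(√(z t))⁻¹ - (t - p) / 2)
    (g' := fun t => -(-(z' t / (2 * √(z t))) / √(z t) ^ 2) - 1 / 2)
    (by linarith : p ≤ p + h)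
    (fun s hs => by
      have hs0 : √(z s) ≠ 0 := (Real.sqrt_pos.2 (h2 s hs)).ne'
      have := (((hz s hs).sqrt (h2 s hs).ne').fun_inv hs0).fun_neg
      exact this.fun_sub (((hasDerivAt_id' s).sub_const p).div_const 2))
    (fun s hs => by
      set w := √(z s) with hw
      have hw0 : 0 < w := Real.sqrt_pos.2 (h2 s hs)
      have hw2 : z s = w ^ 2 := (Real.sq_sqrt (h2 s hs).le).symm
      have h5 : w ^ 3 ≤ z' s := by
        refine le_of_sq_le_sq ?_ (h1 s hs).le
        have := h3 s hs
        rw [hw2] at this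
        nlinarith
      have h6 : -(-(z' s / (2 * w)) / w ^ 2) = z' s / (2 * w ^ 3) := by
        field_simp
      rw [h6, sub_nonneg, div_le_div_iff₀ (by norm_num) (by positivity)]
      linarith)
  have h5 : 0 < (√(z (p + h)))⁻¹ :=
    inv_pos.2 (Real.sqrt_pos.2 (h2 _ ⟨by linarith, le_rfl⟩))
  simp only [sub_self, zero_div, sub_zero, add_sub_cancel_left] at h4
  linarith

/-- During time `T` the bound `z'' ≥ M` lifts `z` to at least `4` and to at least `2 z a`. The
quantity `z'² - 4z³` does not decrease, so `z'² ≥ z³` at time `a + T`, and `lifespan_lt` leaves less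
than `2/√4 = 1` of further life. -/
lemma no_long_convex_solution {z z' f : ℝ → ℝ} {a T M : ℝ} (hT : 0 ≤ T) (hM : 0 < M)
    (hz : ∀ t ∈ Icc a (a + T + 1), HasDerivAt z (z' t) t)
    (hz' : ∀ t ∈ Icc a (a + T + 1), HasDerivAt z' (f t) t)
    (hf : ∀ t ∈ Icc a (a + T + 1), 6 * z t ^ 2 ≤ f t)
    (hfM : ∀ t ∈ Icc a (a + T + 1), M ≤ f t)
    (ha : 0 ≤ z' a) (hTM : |z a| + 4 ≤ M * T ^ 2 / 2) : False := by
  have sub : ∀ {t}, t ∈ Icc a (a + T + 1) → Icc a t ⊆ Icc a (a + T + 1) := fun ht =>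
    Icc_subset_Icc_right ht.2
  have h1 : ∀ t ∈ Icc a (a + T + 1), M * (t - a) ≤ z' t := fun t ht => by
    have := le_of_hasDerivAt_nonneg (g := fun t => z' t - M * (t - a))
      (g' := fun t => f t - M * 1) ht.1
      (fun s hs => (hz' s (sub ht hs)).fun_sub (((hasDerivAt_id' s).sub_const a).const_mul M))
      (fun s hs => by linarith [hfM s (sub ht hs)])
    simp only [sub_self, mul_zero] at this
    linarith
  have hp : a + T ∈ Icc a (a + T + 1) := ⟨by linarith, by linarith⟩
  have h2 : z a + M * T ^ 2 / 2 ≤ z (a + T) := by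
    have := le_of_hasDerivAt_nonneg (g := fun t => z t - M * (t - a) ^ 2 / 2)
      (g' := fun t => z' t - M * (2 * (t - a)) / 2) hp.1
      (fun s hs => (hz s (sub hp hs)).fun_sub (((by
        simpa using ((hasDerivAt_id' s).sub_const a).fun_pow 2 :
          HasDerivAt (fun t : ℝ => (t - a) ^ 2) (2 * (s - a)) s).const_mul M).div_const 2))
      (fun s hs => by linarith [h1 s (sub hp hs)])
    simp only [sub_self, add_sub_cancel_left] at this
    linarith
  have h3 := le_of_hasDerivAt_nonneg (g := fun t => z' t ^ 2 - 4 * z t ^ 3)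
      (g' := fun t => 2 * z' t * f t - 4 * (3 * z t ^ 2 * z' t)) hp.1
      (fun s hs => by
        simpa using ((hz' s (sub hp hs)).fun_pow 2).fun_sub
          (((hz s (sub hp hs)).fun_pow 3).const_mul 4))
      (fun s hs => by
        have a1 := h1 s (sub hp hs)
        have a2 : 0 ≤ M * (s - a) := mul_nonneg hM.le (by linarith [hs.1])
        have b := hf s (sub hp hs)
        have : 0 ≤ z' s * (2 * f s - 12 * z s ^ 2) :=
          mul_nonneg (a2.trans a1) (by linarith)
        linarith)
  have h4 : 4 ≤ z (a + T) := by linarith [neg_abs_le (z a)]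
  have h5 : 2 * z a ≤ z (a + T) := by linarith [le_abs_self (z a)]
  have h6 : 8 * z a ^ 3 ≤ z (a + T) ^ 3 := by
    rcases le_total (z a) 0 with h | h
    · have : z a ^ 3 ≤ 0 := by
        have := mul_nonpos_of_nonneg_of_nonpos (sq_nonneg (z a)) h
        nlinarith
      have : 0 ≤ z (a + T) ^ 3 := by positivity
      linarith
    · calc 8 * z a ^ 3 = (2 * z a) ^ 3 := by ring
        _ ≤ _ := by gcongr
  have h7 : z (a + T) ^ 3 ≤ z' (a + T) ^ 2 := by
    have : 0 ≤ z (a + T) ^ 3 := by positivity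
    nlinarith [sq_nonneg (z' a)]
  have h8 : 0 < z' (a + T) := by
    have := h1 _ hp
    have h9 : 0 ≤ z' (a + T) := le_trans (mul_nonneg hM.le (by linarith)) this
    refine lt_of_le_of_ne h9 fun h => ?_
    rw [← h] at h7
    have : 0 < z (a + T) ^ 3 := by positivity
    linarith
  have sub' : Icc (a + T) (a + T + 1) ⊆ Icc a (a + T + 1) := Icc_subset_Icc_left hp.1
  have h9 := lifespan_lt zero_le_one (fun t ht => hz t (sub' ht)) (fun t ht => hz' t (sub' ht))
    (fun t ht => hf t (sub' ht)) (by linarith) h8 h7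
  have h10 : 2 ≤ √(z (a + T)) := Real.le_sqrt_of_sq_le (by linarith)
  have h11 : (√(z (a + T)))⁻¹ ≤ 2⁻¹ := inv_anti₀ (by norm_num) h10
  linarith

/-! ### Endpoints of open intervals -/

lemma exists_isLUB_of_not_mem {I : Set ℝ} (hI' : IsPreconnected I) {c τ : ℝ}
    (hc : c ∈ I) (hτ : τ ∉ I) (hcτ : c < τ) : ∃ b ≤ τ, IsLUB I b := by
  have hub : τ ∈ upperBounds I := fun x hx => by
    by_contra! h
    exact hτ (hI'.ordConnected.out hc hx ⟨hcτ.le, h.le⟩)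
  exact ⟨sSup I, csSup_le ⟨c, hc⟩ hub, isLUB_csSup ⟨c, hc⟩ ⟨τ, hub⟩⟩

lemma IsLUB.not_mem_of_isOpen {I : Set ℝ} {b : ℝ} (h : IsLUB I b) (hI : IsOpen I) : b ∉ I := by
  intro hb
  obtain ⟨ε, hε, hball⟩ := Metric.isOpen_iff.1 hI b hb
  have : b + ε / 2 ∈ I := hball (by rw [Real.ball_eq_Ioo]; constructor <;> linarith)
  linarith [h.1 this]

lemma IsLUB.lt_of_mem_isOpen {I : Set ℝ} {b c : ℝ} (h : IsLUB I b) (hI : IsOpen I)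
    (hc : c ∈ I) : c < b :=
  lt_of_le_of_ne (h.1 hc) fun e => h.not_mem_of_isOpen hI (e ▸ hc)

lemma IsLUB.Ico_subset {I : Set ℝ} {b c : ℝ} (h : IsLUB I b) (hI' : IsPreconnected I)
    (hc : c ∈ I) : Ico c b ⊆ I := by
  intro x hx
  obtain ⟨d, hd, hxd⟩ := (lt_isLUB_iff h).1 hx.2
  exact hI'.ordConnected.out hc hd ⟨hx.1, hxd.le⟩

lemma exists_Ioc_subset_of_not_mem {I : Set ℝ} (hI' : IsPreconnected I) (hI : IsOpen I)
    {c τ : ℝ} (hc : c ∈ I) (hτ : τ ∉ I) (hτc : τ < c) : ∃ a < c, a ∉ I ∧ Ioc a c ⊆ I := by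
  have hlb : τ ∈ lowerBounds I := fun x hx => by
    by_contra! h
    exact hτ (hI'.ordConnected.out hx hc ⟨h.le, hτc.le⟩)
  have h : IsGLB I (sInf I) := isGLB_csInf ⟨c, hc⟩ ⟨τ, hlb⟩
  have hn : sInf I ∉ I := fun hb => by
    obtain ⟨ε, hε, hball⟩ := Metric.isOpen_iff.1 hI _ hb
    have : sInf I - ε / 2 ∈ I := hball (by rw [Real.ball_eq_Ioo]; constructor <;> linarith)
    linarith [h.1 this]
  refine ⟨sInf I, lt_of_le_of_ne (h.1 hc) fun e => hn (e.symm ▸ hc), hn, fun x hx => ?_⟩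
  obtain ⟨d, hd, hdx⟩ := (isGLB_lt_iff h).1 hx.1
  exact hI'.ordConnected.out hd hc ⟨hdx.le, hx.2⟩

/-! ### Convexity on the nonpositive half-line -/

section convexity
variable {I : Set ℝ} {y : ℝ → ℝ}

lemma IsP1Solution.ordConnected (h : IsP1Solution I y) : I.OrdConnected :=
  h.isConnected.isPreconnected.ordConnected

lemma IsP1Solution.exists_large (h : IsP1Solution I y) {τ : ℝ} (hτ : τ ∉ I) {S : Set ℝ}
    (hS : S ⊆ I) (hτS : τ ∈ closure S) (R : ℝ) : ∃ t ∈ S, R < ‖phase y t‖ := by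
  by_contra! hc
  have : (𝓝[S] τ).NeBot := mem_closure_iff_nhdsWithin_neBot.1 hτS
  have h1 : ∃ᶠ t in 𝓝[S] τ, ‖phase y t‖ ≤ R :=
    (show ∀ᶠ t in 𝓝[S] τ, ‖phase y t‖ ≤ R by
      filter_upwards [self_mem_nhdsWithin] with t ht using hc t ht).frequently
  exact h.not_frequently_bounded hτ R (h1.filter_mono (nhdsWithin_mono τ hS))

lemma IsP1Solution.strictMonoOn_deriv (h : IsP1Solution I y) :
    StrictMonoOn (deriv y) (I ∩ Iic 0) := by
  refine strictMonoOn_of_deriv_pos (h.ordConnected.inter ordConnected_Iic).convex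
    (h.solves.continuousOn_deriv.mono inter_subset_left) fun x hx => ?_
  rw [interior_inter, interior_Iic] at hx
  rw [(h.solves x (interior_subset hx.1)).2.deriv]
  have : x < 0 := hx.2
  nlinarith [sq_nonneg (y x)]

lemma IsP1Solution.lt_of_deriv_nonneg (h : IsP1Solution I y) {s t : ℝ} (hs : s ∈ I)
    (ht : t ∈ I) (ht0 : t ≤ 0) (hst : s < t) (hd : 0 ≤ deriv y s) : y s < y t := by
  have hsub : Icc s t ⊆ I := h.ordConnected.out hs ht
  refine lt_of_hasDerivAt_pos hst (fun x hx => h.solves.hasDerivAt (hsub hx)) fun x hx => ?_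
  exact hd.trans_lt (h.strictMonoOn_deriv ⟨hs, hst.le.trans ht0⟩
    ⟨hsub (Ioo_subset_Icc_self hx), hx.2.le.trans ht0⟩ hx.1)

/-- A critical point on the nonpositive semi-axis is a strict minimum there. -/
lemma IsP1Solution.lt_of_critical (h : IsP1Solution I y) {m x : ℝ} (hm : m ∈ I) (hm0 : m ≤ 0)
    (hd : deriv y m = 0) (hx : x ∈ I) (hx0 : x ≤ 0) (hne : x ≠ m) : y m < y x := by
  rcases lt_or_gt_of_ne hne with hlt | hlt
  · have hsub : Icc x m ⊆ I := h.ordConnected.out hx hm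
    have := lt_of_hasDerivAt_pos (g := fun t => - y t) (g' := fun t => - deriv y t) hlt
      (fun t ht => (h.solves.hasDerivAt (hsub ht)).fun_neg) fun t ht => by
        have := h.strictMonoOn_deriv ⟨hsub (Ioo_subset_Icc_self ht), ht.2.le.trans hm0⟩
          ⟨hm, hm0⟩ ht.2
        linarith
    linarith
  · exact h.lt_of_deriv_nonneg hm hx hx0 hlt hd.ge

/-- By convexity `y'` is bounded below on `[c, b)`, hence so is `y`. An upper bound for `y` would
then bound `y''` and with it `y'`, contradicting the escape of `(y, y')` from compact sets at `b`.
-/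
lemma IsP1Solution.unbounded_above (h : IsP1Solution I y) {b : ℝ} (hb : IsLUB I b) (hb0 : b ≤ 0)
    {c : ℝ} (hc : c ∈ I) (R : ℝ) : ∃ t ∈ Ico c b, R < y t := by
  by_contra! hR
  have hcb : c < b := hb.lt_of_mem_isOpen h.isOpen hc
  have hsub : Ico c b ⊆ I := hb.Ico_subset h.isConnected.isPreconnected hc
  have sub : ∀ {t}, t ∈ Ico c b → Icc c t ⊆ Ico c b := fun ht s hs =>
    ⟨hs.1, hs.2.trans_lt ht.2⟩
  have hcl : b ∈ closure (Ico c b) := by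
    rw [closure_Ico hcb.ne]; exact right_mem_Icc.2 hcb.le
  have h1 : ∀ t ∈ Ico c b, deriv y c ≤ deriv y t := fun t ht =>
    h.strictMonoOn_deriv.monotoneOn ⟨hc, hcb.le.trans hb0⟩ ⟨hsub ht, ht.2.le.trans hb0⟩ ht.1
  have h2 : ∀ t ∈ Ico c b, y c - |deriv y c| * (b - c) ≤ y t := fun t ht => by
    have := le_of_hasDerivAt_nonneg (g := fun t => y t + |deriv y c| * (t - c))
      (g' := fun t => deriv y t + |deriv y c| * 1) ht.1
      (fun s hs => (h.solves.hasDerivAt (hsub (sub ht hs))).fun_add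
        (((hasDerivAt_id' s).sub_const c).const_mul _))
      (fun s hs => by linarith [h1 s (sub ht hs), neg_abs_le (deriv y c)])
    have h3 : |deriv y c| * (t - c) ≤ |deriv y c| * (b - c) := by
      gcongr; exact ht.2.le
    simp only [sub_self, mul_zero] at this
    linarith
  set Q : ℝ := |R| + |y c| + |deriv y c| * (b - c) with hQ
  have hQ0 : 0 ≤ |deriv y c| * (b - c) := mul_nonneg (abs_nonneg _) (by linarith)
  have h3 : ∀ t ∈ Ico c b, |y t| ≤ Q := fun t ht => by
    rw [abs_le]
    constructor
    · linarith [h2 t ht, neg_abs_le (y c), abs_nonneg R]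
    · linarith [hR t ht, le_abs_self R, abs_nonneg (y c)]
  set N : ℝ := 6 * Q ^ 2 + |c| with hN
  have hN0 : 0 ≤ N := by positivity
  have h4 : ∀ t ∈ Ico c b, deriv y t ≤ deriv y c + N * (b - c) := fun t ht => by
    have := le_of_hasDerivAt_nonneg (g := fun t => N * (t - c) - deriv y t)
      (g' := fun t => N * 1 - (6 * y t ^ 2 - t)) ht.1
      (fun s hs => (((hasDerivAt_id' s).sub_const c).const_mul _).fun_sub
        (h.solves s (hsub (sub ht hs))).2)
      (fun s hs => by
        have a1 : y s ^ 2 ≤ Q ^ 2 := sq_le_sq' (abs_le.1 (h3 s (sub ht hs))).1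
          (abs_le.1 (h3 s (sub ht hs))).2
        linarith [neg_abs_le c, hs.1])
    have h3 : N * (t - c) ≤ N * (b - c) := by gcongr; exact ht.2.le
    simp only [sub_self, mul_zero] at this
    linarith
  obtain ⟨t, ht, hlt⟩ := h.exists_large (hb.not_mem_of_isOpen h.isOpen) hsub hcl
    (max Q (|deriv y c| + N * (b - c)))
  have h5 : 0 ≤ N * (b - c) := mul_nonneg hN0 (by linarith)
  have h6 : ‖phase y t‖ ≤ max Q (|deriv y c| + N * (b - c)) := by
    rw [Prod.norm_def, phase, Real.norm_eq_abs, Real.norm_eq_abs]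
    refine max_le_max (h3 t ht) (abs_le.2 ⟨?_, ?_⟩)
    · linarith [h1 t ht, neg_abs_le (deriv y c)]
    · linarith [h4 t ht, le_abs_self (deriv y c)]
  linarith

lemma IsP1Solution.exists_deriv_pos (h : IsP1Solution I y) {b : ℝ} (hb : IsLUB I b)
    (hb0 : b ≤ 0) : ∃ s ∈ I, 0 < deriv y s := by
  obtain ⟨c, hc⟩ := h.isConnected.nonempty
  obtain ⟨t, ht, hlt⟩ := h.unbounded_above hb hb0 hc (y c)
  by_contra! hn
  have hsub : Icc c t ⊆ I := fun s hs =>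
    hb.Ico_subset h.isConnected.isPreconnected hc ⟨hs.1, hs.2.trans_lt ht.2⟩
  have := le_of_hasDerivAt_nonneg (g := fun t => -y t) (g' := fun t => -deriv y t) ht.1
    (fun s hs => (h.solves.hasDerivAt (hsub hs)).fun_neg)
    (fun s hs => by linarith [hn s (hsub hs)])
  linarith

/-- A solution tends to `+∞` at a nonpositive right end of its interval of existence. -/
lemma IsP1Solution.tendsto_atTop (h : IsP1Solution I y) {b : ℝ} (hb : IsLUB I b)
    (hb0 : b ≤ 0) : Tendsto y (𝓝[<] b) atTop := by
  obtain ⟨s, hs, hpos⟩ := h.exists_deriv_pos hb hb0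
  refine Filter.tendsto_atTop.2 fun R => ?_
  obtain ⟨t, ht, hlt⟩ := h.unbounded_above hb hb0 hs R
  have hsub := hb.Ico_subset h.isConnected.isPreconnected hs
  have hd : 0 ≤ deriv y t := hpos.le.trans (h.strictMonoOn_deriv.monotoneOn
    ⟨hs, (ht.1.trans ht.2.le).trans hb0⟩ ⟨hsub ht, ht.2.le.trans hb0⟩ ht.1)
  filter_upwards [Ioo_mem_nhdsLT ht.2] with x hx
  exact (hlt.trans (h.lt_of_deriv_nonneg (hsub ht) (hsub ⟨ht.1.trans hx.1.le, hx.2⟩)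
    (hx.2.le.trans hb0) hx.1 hd)).le

/-- After the reflection `t = -x` the equation is `z'' = 6z² + t`, which drives `z'` to nonnegative
values and then `z` to blow-up. -/
lemma IsP1Solution.exists_not_mem_left (h : IsP1Solution I y) {c : ℝ} : ∃ a < c, a ∉ I := by
  by_contra! hall
  set a₀ : ℝ := |c| + 1 with ha₀
  have hmem : ∀ t, a₀ ≤ t → -t ∈ I := fun t ht => hall _ (by linarith [neg_abs_le c])
  set z : ℝ → ℝ := fun t => y (-t)
  set z' : ℝ → ℝ := fun t => -deriv y (-t)
  have hz : ∀ t, a₀ ≤ t → HasDerivAt z (z' t) t := fun t ht =>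
    by
    simpa [z, z', Function.comp_def] using! (h.solves.hasDerivAt (hmem t ht)).comp t (hasDerivAt_neg t)
  have hz' : ∀ t, a₀ ≤ t → HasDerivAt z' (6 * z t ^ 2 + t) t := fun t ht => by
    simpa [z, z', Function.comp_def] using!
      ((h.solves _ (hmem t ht)).2.comp t (hasDerivAt_neg t)).fun_neg
  have h1 : 1 ≤ a₀ := by linarith [abs_nonneg c]
  set a₁ := a₀ + |z' a₀| with ha₁
  have ha₁' : a₀ ≤ a₁ := by linarith [abs_nonneg (z' a₀)]
  have h2 : 0 ≤ z' a₁ := by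
    have := le_of_hasDerivAt_nonneg (g := fun t => z' t - t)
      (g' := fun t => 6 * z t ^ 2 + t - 1) ha₁'
      (fun s hs => (hz' s hs.1).fun_sub (hasDerivAt_id' s))
      (fun s hs => by nlinarith [sq_nonneg (z s), hs.1])
    linarith [neg_abs_le (z' a₀)]
  refine no_long_convex_solution (z := z) (z' := z') (f := fun t => 6 * z t ^ 2 + t) (a := a₁)
    (T := √(2 * (|z a₁| + 4))) (M := 1) (Real.sqrt_nonneg _) one_pos
    (fun t ht => hz t (ha₁'.trans ht.1)) (fun t ht => hz' t (ha₁'.trans ht.1)) ?_ ?_ h2 ?_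
  · intro t ht; linarith [ht.1]
  · intro t ht; nlinarith [ht.1, sq_nonneg (z t)]
  · rw [Real.sq_sqrt (by positivity)]; linarith

lemma IsP1Solution.exists_critical (h : IsP1Solution I y) (hI : I ⊆ Iic 0) :
    ∃ b m : ℝ, b ≤ 0 ∧ IsLUB I b ∧ m ∈ I ∧ deriv y m = 0 := by
  obtain ⟨c, hc⟩ := h.isConnected.nonempty
  have hc0 : c ≤ 0 := hI hc
  have hb : IsLUB I (sSup I) := isLUB_csSup ⟨c, hc⟩ ⟨0, fun x hx => hI hx⟩
  have hb0 : sSup I ≤ 0 := csSup_le ⟨c, hc⟩ fun x hx => hI hx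
  refine ⟨sSup I, ?_⟩
  obtain ⟨s, hs, hspos⟩ := h.exists_deriv_pos hb hb0
  by_cases hx : ∃ x ∈ I, deriv y x ≤ 0
  · obtain ⟨x, hx, hx'⟩ := hx
    obtain ⟨m, hm, hm'⟩ := h.isConnected.isPreconnected.intermediate_value hx hs
      h.solves.continuousOn_deriv ⟨hx', hspos.le⟩
    exact ⟨m, hb0, hb, hm, hm'⟩
  -- If `y' > 0` throughout, then on the way to the finite left end `a` convexity keeps `y'` between
  -- `0` and `y'(s)`, so the phase curve is bounded, which is impossible.
  · exfalso
    push Not at hx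
    obtain ⟨a₀, ha₀, ha₀I⟩ := h.exists_not_mem_left (c := s)
    obtain ⟨a, has, haI, hsub⟩ :=
      exists_Ioc_subset_of_not_mem h.isConnected.isPreconnected h.isOpen hs ha₀I ha₀
    have hcl : a ∈ closure (Ioc a s) := by
      rw [closure_Ioc has.ne]; exact left_mem_Icc.2 has.le
    have h0 : ∀ t ∈ Ioc a s, deriv y t ≤ deriv y s := fun t ht =>
      h.strictMonoOn_deriv.monotoneOn ⟨hsub ht, hI (hsub ht)⟩ ⟨hs, hI hs⟩ ht.2
    have sub : ∀ {t}, t ∈ Ioc a s → Icc t s ⊆ Ioc a s := fun ht x hx =>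
      ⟨ht.1.trans_le hx.1, hx.2⟩
    have h1 : ∀ t ∈ Ioc a s, y t ≤ y s := fun t ht =>
      le_of_hasDerivAt_nonneg ht.2 (fun x hx => h.solves.hasDerivAt (hsub (sub ht hx)))
        (fun x hx' => (hx x (hsub (sub ht hx'))).le)
    have h2 : ∀ t ∈ Ioc a s, y s - deriv y s * (s - a) ≤ y t := fun t ht => by
      have := le_of_hasDerivAt_nonneg (g := fun t => deriv y s * (t - a) - y t)
        (g' := fun t => deriv y s * 1 - deriv y t) ht.2
        (fun x hx => (((hasDerivAt_id' x).sub_const a).const_mul _).fun_sub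
          (h.solves.hasDerivAt (hsub (sub ht hx))))
        (fun x hx => by linarith [h0 x (sub ht hx)])
      have : 0 ≤ deriv y s * (t - a) := mul_nonneg hspos.le (by linarith [ht.1])
      linarith
    have h3 : 0 ≤ deriv y s * (s - a) := mul_nonneg hspos.le (by linarith)
    obtain ⟨t, ht, hlt⟩ := h.exists_large haI hsub hcl
      (max (|y s| + deriv y s * (s - a)) (deriv y s))
    have h6 : ‖phase y t‖ ≤ max (|y s| + deriv y s * (s - a)) (deriv y s) := by
      rw [Prod.norm_def, phase, Real.norm_eq_abs, Real.norm_eq_abs]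
      refine max_le_max (abs_le.2 ⟨?_, ?_⟩) (abs_le.2 ⟨?_, ?_⟩)
      · linarith [h2 t ht, neg_abs_le (y s)]
      · linarith [h1 t ht, le_abs_self (y s)]
      · linarith [hx t (hsub ht)]
      · exact h0 t ht
    linarith
end convexity

/-! ### Comparison of solutions with the same minimum value -/

section comparison
variable {I₁ I₂ : Set ℝ} {y₁ y₂ : ℝ → ℝ}

/-- Of two solutions with the same minimum value, the one whose minimum lies further to the left
grows faster from its minimum on. -/
lemma IsP1Solution.comparison (h₁ : IsP1Solution I₁ y₁) (h₂ : IsP1Solution I₂ y₂)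
    {m₁ m₂ yl T : ℝ} (hm : m₁ < m₂) (hm₁ : m₁ ∈ I₁) (hm₂ : m₂ ∈ I₂) (hp₁ : phase y₁ m₁ = (yl, 0))
    (hp₂ : phase y₂ m₂ = (yl, 0)) (hT₁ : m₁ + T ∈ I₁) (hT₂ : m₂ + T ∈ I₂) (hT0 : m₂ + T ≤ 0)
    (hT : 0 < T) : y₂ (m₂ + T) < y₁ (m₁ + T) := by
  obtain ⟨hy₁, hd₁⟩ := Prod.ext_iff.1 hp₁
  obtain ⟨hy₂, hd₂⟩ := Prod.ext_iff.1 hp₂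
  simp only [phase] at hy₁ hd₁ hy₂ hd₂
  have mem₁ : ∀ t ∈ Icc 0 T, m₁ + t ∈ I₁ := fun t ht =>
    h₁.ordConnected.out hm₁ hT₁ ⟨by linarith [ht.1], by linarith [ht.2]⟩
  have mem₂ : ∀ t ∈ Icc 0 T, m₂ + t ∈ I₂ := fun t ht =>
    h₂.ordConnected.out hm₂ hT₂ ⟨by linarith [ht.1], by linarith [ht.2]⟩
  have du₁ : ∀ t ∈ Icc 0 T, HasDerivAt (fun t => y₁ (m₁ + t)) (deriv y₁ (m₁ + t)) t :=
    fun t ht => (h₁.solves.hasDerivAt (mem₁ t ht)).comp_const_add m₁ t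
  have du₂ : ∀ t ∈ Icc 0 T, HasDerivAt (fun t => y₂ (m₂ + t)) (deriv y₂ (m₂ + t)) t :=
    fun t ht => (h₂.solves.hasDerivAt (mem₂ t ht)).comp_const_add m₂ t
  have dv₁ : ∀ t ∈ Icc 0 T, HasDerivAt (fun t => deriv y₁ (m₁ + t))
      (6 * y₁ (m₁ + t) ^ 2 - (m₁ + t)) t :=
    fun t ht => (h₁.solves _ (mem₁ t ht)).2.comp_const_add m₁ t
  have dv₂ : ∀ t ∈ Icc 0 T, HasDerivAt (fun t => deriv y₂ (m₂ + t))
      (6 * y₂ (m₂ + t) ^ 2 - (m₂ + t)) t :=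
    fun t ht => (h₂.solves _ (mem₂ t ht)).2.comp_const_add m₂ t
  set u₁ : ℝ → ℝ := fun t => y₁ (m₁ + t)
  set u₂ : ℝ → ℝ := fun t => y₂ (m₂ + t)
  set v₁ : ℝ → ℝ := fun t => deriv y₁ (m₁ + t)
  set v₂ : ℝ → ℝ := fun t => deriv y₂ (m₂ + t)
  have e₁ : u₁ 0 = yl := by simpa [u₁] using hy₁
  have e₂ : u₂ 0 = yl := by simpa [u₂] using hy₂
  have e₃ : v₁ 0 = 0 := by simpa [v₁] using hd₁
  have e₄ : v₂ 0 = 0 := by simpa [v₂] using hd₂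
  have hz : (0 : ℝ) ∈ Icc 0 T := ⟨le_rfl, hT.le⟩
  change u₂ T < u₁ T
  by_contra! hcon
  -- positivity of the difference near the minimum
  obtain ⟨ε, hε, hεpos⟩ : ∃ ε > 0, ∀ t ∈ Ioc 0 ε, t ≤ T → 0 < u₁ t - u₂ t := by
    have hc : ContinuousAt (fun t => (6 * u₁ t ^ 2 - (m₁ + t)) - (6 * u₂ t ^ 2 - (m₂ + t))) 0 := by
      have := (du₁ 0 hz).continuousAt
      have := (du₂ 0 hz).continuousAt
      fun_prop
    -- At `t = 0` the values agree, so the second derivatives differ by exactly `m₂ - m₁ > 0`.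
    have hpos : ∀ᶠ t in 𝓝 0,
        0 < (6 * u₁ t ^ 2 - (m₁ + t)) - (6 * u₂ t ^ 2 - (m₂ + t)) :=
      hc.eventually_const_lt (by simp only [e₁, e₂]; linarith)
    obtain ⟨ε, hε, hb⟩ := Metric.eventually_nhds_iff.1 hpos
    have hb' : ∀ t, 0 ≤ t → t < ε →
        0 < (6 * u₁ t ^ 2 - (m₁ + t)) - (6 * u₂ t ^ 2 - (m₂ + t)) := fun t h0 ht =>
      hb (by rw [Real.dist_eq, sub_zero, abs_of_nonneg h0]; exact ht)
    refine ⟨ε / 2, by positivity, fun t ht htT => ?_⟩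
    have sub : ∀ {s}, s ≤ t → Icc 0 s ⊆ Icc 0 T := fun hs x hx =>
      ⟨hx.1, hx.2.trans (hs.trans htT)⟩
    have hv : ∀ s ∈ Ioo 0 t, 0 < v₁ s - v₂ s := fun s hs => by
      have := lt_of_hasDerivAt_pos (g := fun t => v₁ t - v₂ t) hs.1
        (fun x hx => (dv₁ x (sub hs.2.le hx)).fun_sub (dv₂ x (sub hs.2.le hx)))
        (fun x hx => hb' x hx.1.le (by linarith [hx.2, hs.2, ht.2]))
      simpa only [e₃, e₄, sub_self] using this
    have := lt_of_hasDerivAt_pos (g := fun t => u₁ t - u₂ t) ht.1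
      (fun x hx => (du₁ x (sub le_rfl hx)).fun_sub (du₂ x (sub le_rfl hx))) hv
    simpa only [e₁, e₂, sub_self] using this
  -- the first crossing
  have hεT : ε < T := by
    by_contra! hle
    linarith [hεpos T ⟨hT, hle⟩ le_rfl]
  have hcont : ContinuousOn (fun t => u₁ t - u₂ t) (Icc 0 T) := fun t ht =>
    ((du₁ t ht).fun_sub (du₂ t ht)).continuousAt.continuousWithinAt
  have hsubε : Icc ε T ⊆ Icc 0 T := Icc_subset_Icc_left hε.le
  obtain ⟨τ, ⟨⟨hετ, hτT⟩, hτ0⟩, hτmin⟩ : ∃ τ, IsLeast (Icc ε T ∩ {t | u₁ t - u₂ t ≤ 0}) τ := by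
    have hcl : IsClosed (Icc ε T ∩ {t | u₁ t - u₂ t ≤ 0}) :=
      (hcont.mono hsubε).preimage_isClosed_of_isClosed isClosed_Icc isClosed_Iic
    exact (isCompact_Icc.of_isClosed_subset hcl inter_subset_left).exists_isLeast
      ⟨T, ⟨hεT.le, le_rfl⟩, by simpa using hcon⟩
  have hτpos : 0 < τ := hε.trans_le hετ
  have hτm : τ ∈ Icc 0 T := ⟨hτpos.le, hτT⟩
  have hwpos : ∀ t ∈ Ioo 0 τ, 0 < u₁ t - u₂ t := fun t ht => by
    rcases le_total t ε with hle | hle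
    · exact hεpos t ⟨ht.1, hle⟩ (ht.2.le.trans hτT)
    · by_contra! hn
      exact absurd (hτmin ⟨⟨hle, ht.2.le.trans hτT⟩, hn⟩) (not_le.2 ht.2)
  have dw : HasDerivAt (fun t => u₁ t - u₂ t) (v₁ τ - v₂ τ) τ := (du₁ τ hτm).fun_sub (du₂ τ hτm)
  have hev : ∀ᶠ t in 𝓝[<] τ, t ∈ Ioo 0 τ := Ioo_mem_nhdsLT hτpos
  have hτeq : u₁ τ - u₂ τ = 0 := by
    refine le_antisymm hτ0 ?_
    refine ge_of_tendsto (dw.continuousAt.tendsto.mono_left nhdsWithin_le_nhds :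
      Tendsto _ (𝓝[<] τ) _) ?_
    filter_upwards [hev] with t ht using (hwpos t ht).le
  have hslope : v₁ τ - v₂ τ ≤ 0 := by
    have h1 : Tendsto (slope (fun t => u₁ t - u₂ t) τ) (𝓝[<] τ) (𝓝 (v₁ τ - v₂ τ)) :=
      (hasDerivAt_iff_tendsto_slope.1 dw).mono_left (nhdsWithin_mono τ fun t ht => ne_of_lt ht)
    refine le_of_tendsto h1 ?_
    filter_upwards [hev] with t ht
    rw [slope_def_field, hτeq, sub_zero]
    exact div_nonpos_of_nonneg_of_nonpos (hwpos t ht).le (by linarith [ht.2])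
  -- the energies at the crossing
  have sub : Icc 0 τ ⊆ Icc 0 T := Icc_subset_Icc_right hτT
  have dE : ∀ {m : ℝ} {u v : ℝ → ℝ} {t : ℝ}, HasDerivAt u (v t) t →
      HasDerivAt v (6 * u t ^ 2 - (m + t)) t →
      HasDerivAt (fun t => v t ^ 2 / 2 - 2 * u t ^ 3 + (m + t) * u t) (u t) t := by
    intro m u v t hu hv
    have := (((hv.fun_pow 2).div_const 2).fun_sub ((hu.fun_pow 3).const_mul 2)).fun_add
      (((hasDerivAt_id' t).const_add m).fun_mul hu)
    convert! this using 1
    push_cast; ring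
  have hE := lt_of_hasDerivAt_pos (g := fun t => (v₁ t ^ 2 / 2 - 2 * u₁ t ^ 3 + (m₁ + t) * u₁ t) -
      (v₂ t ^ 2 / 2 - 2 * u₂ t ^ 3 + (m₂ + t) * u₂ t)) hτpos
    (fun t ht => (dE (du₁ t (sub ht)) (dv₁ t (sub ht))).fun_sub
      (dE (du₂ t (sub ht)) (dv₂ t (sub ht)))) hwpos
  simp only [e₁, e₂, e₃, e₄] at hE
  have hueq : u₁ τ = u₂ τ := by linarith
  rw [hueq] at hE
  have hm₁0 : m₁ ≤ 0 := by linarith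
  have hm₂0 : m₂ ≤ 0 := by linarith
  have hU : yl < u₂ τ := by
    rw [← hy₂]
    exact h₂.lt_of_deriv_nonneg hm₂ (mem₂ τ hτm) (by linarith) (by linarith) hd₂.ge
  have hv₁ : 0 < v₁ τ := by
    rw [← hd₁]
    exact h₁.strictMonoOn_deriv ⟨hm₁, hm₁0⟩ ⟨mem₁ τ hτm, by simp only [mem_Iic]; linarith⟩
      (by linarith)
  have hv₂ : 0 < v₂ τ := by
    rw [← hd₂]
    exact h₂.strictMonoOn_deriv ⟨hm₂, hm₂0⟩ ⟨mem₂ τ hτm, by simp only [mem_Iic]; linarith⟩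
      (by linarith)
  have hmU : 0 < (m₂ - m₁) * (u₂ τ - yl) := mul_pos (by linarith) (by linarith)
  -- With `U` the common value at `τ`, the energy inequality reads `v₁² - v₂² > 2(m₂ - m₁)(U - yl) >
  -- 0`, whereas `0 < v₁ ≤ v₂` at the crossing.
  nlinarith

/-- On so long an interval `y₁` would be bounded by compactness, although it dominates a translate
of the unbounded `y₂`. Thus the time from minimum to blow-up does not decrease with `m`, and the
right end strictly increases. -/
lemma IsP1Solution.not_mem_of_lt (h₁ : IsP1Solution I₁ y₁) (h₂ : IsP1Solution I₂ y₂)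
    {m₁ m₂ yl b : ℝ} (hm : m₁ < m₂) (hm₁ : m₁ ∈ I₁) (hm₂ : m₂ ∈ I₂) (hp₁ : phase y₁ m₁ = (yl, 0))
    (hp₂ : phase y₂ m₂ = (yl, 0)) (hb : IsLUB I₂ b) (hb0 : b ≤ 0) : m₁ + (b - m₂) ∉ I₁ := by
  intro hmem
  have hsub₁ : Icc m₁ (m₁ + (b - m₂)) ⊆ I₁ := h₁.ordConnected.out hm₁ hmem
  obtain ⟨R, hR⟩ := isCompact_Icc.bddAbove_image (h₁.solves.continuousOn.mono hsub₁)
  have hy₂ : y₂ m₂ = yl := congrArg Prod.fst hp₂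
  obtain ⟨t, ht, hlt⟩ := h₂.unbounded_above hb hb0 hm₂ (max R yl)
  have hne : m₂ < t := lt_of_le_of_ne ht.1 fun e => by
    rw [← e, hy₂] at hlt; exact absurd (le_max_right R yl) (not_le.2 hlt)
  have hmt : m₁ + (t - m₂) ∈ Icc m₁ (m₁ + (b - m₂)) :=
    ⟨by linarith [ht.1], by linarith [ht.2]⟩
  have h3 : m₂ + (t - m₂) = t := by ring
  have := h₁.comparison h₂ (T := t - m₂) hm hm₁ hm₂ hp₁ hp₂ (hsub₁ hmt)
    (by rw [h3]; exact hb.Ico_subset h₂.isConnected.isPreconnected hm₂ ht)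
    (by rw [h3]; exact ht.2.le.trans hb0) (by linarith)
  rw [h3] at this
  have h4 := hR (mem_image_of_mem y₁ hmt)
  linarith [le_max_left R yl]

end comparison

/-! ### The minimum, uniqueness and the infimum of minimum points -/

section minimum
variable {I : Set ℝ} {y : ℝ → ℝ}

lemma IsP1Solution.isLeast_of_critical (h : IsP1Solution I y) (hI : I ⊆ Iic 0) {m yl : ℝ}
    (hm : m ∈ I) (hp : phase y m = (yl, 0)) : IsLeast (y '' I) yl := by
  obtain ⟨hy, hd⟩ := Prod.ext_iff.1 hp
  simp only [phase] at hy hd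
  refine ⟨⟨m, hm, hy⟩, ?_⟩
  rintro _ ⟨x, hx, rfl⟩
  rcases eq_or_ne x m with rfl | hne
  · exact hy.ge
  · rw [← hy]; exact (h.lt_of_critical hm (hI hm) hd hx (hI hx) hne).le

lemma IsP1Solution.phase_of_isLeast (h : IsP1Solution I y) {yl : ℝ} (hl : IsLeast (y '' I) yl) :
    ∃ m ∈ I, phase y m = (yl, 0) := by
  obtain ⟨⟨m, hm, hy⟩, hmin⟩ := hl
  refine ⟨m, hm, Prod.ext hy ?_⟩
  refine IsLocalMin.deriv_eq_zero ?_
  filter_upwards [h.isOpen.mem_nhds hm] with x hx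
  rw [hy]; exact hmin ⟨x, hx, rfl⟩

lemma IsP1Solution.setOf_eq_singleton (h : IsP1Solution I y) (hI : I ⊆ Iic 0) {m yl : ℝ}
    (hm : m ∈ I) (hp : phase y m = (yl, 0)) : {x | x ∈ I ∧ y x = yl} = {m} := by
  obtain ⟨hy, hd⟩ := Prod.ext_iff.1 hp
  simp only [phase] at hy hd
  ext x
  constructor
  · rintro ⟨hx, hyx⟩
    by_contra hne
    have := h.lt_of_critical hm (hI hm) hd hx (hI hx) hne
    linarith
  · rintro rfl; exact ⟨hm, hy⟩

/-- The right pole and the minimum value determine the solution. -/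
lemma IsP1Solution.unique_of_isLUB {I' : Set ℝ} {y' : ℝ → ℝ} (h : IsP1Solution I y)
    (h' : IsP1Solution I' y') {b m m' yl : ℝ} (hb0 : b ≤ 0) (hb : IsLUB I b) (hb' : IsLUB I' b)
    (hm : m ∈ I) (hm' : m' ∈ I') (hp : phase y m = (yl, 0)) (hp' : phase y' m' = (yl, 0)) :
    I = I' ∧ EqOn y y' I := by
  rcases lt_trichotomy m m' with hlt | rfl | hlt
  · refine absurd ?_ (h.not_mem_of_lt h' hlt hm hm' hp hp' hb' hb0)
    have := hb'.lt_of_mem_isOpen h'.isOpen hm'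
    exact hb.Ico_subset h.isConnected.isPreconnected hm ⟨by linarith, by linarith⟩
  · exact h.eq_of_phase_eq h' hm hm' (hp.trans hp'.symm)
  · refine absurd ?_ (h'.not_mem_of_lt h hlt hm' hm hp' hp hb hb0)
    have := hb.lt_of_mem_isOpen h.isOpen hm
    exact hb'.Ico_subset h'.isConnected.isPreconnected hm' ⟨by linarith, by linarith⟩

/-- The right end is strictly increasing in the minimum point, so a solution with minimum at `m'`
survives past `b` exactly when `m' > m`. At `m' = m` it is `y` itself, which ends at `b`. -/
lemma IsP1Solution.xminValues_eq (h : IsP1Solution I y) {b m yl : ℝ} (hb0 : b ≤ 0)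
    (hb : IsLUB I b) (hm : m ∈ I) (hp : phase y m = (yl, 0)) : xminValues b yl = Ioo m b := by
  have hmb : m < b := hb.lt_of_mem_isOpen h.isOpen hm
  ext m'
  constructor
  · rintro ⟨y₀, hy₀, J, z, hz, hbJ, hzb, hmJ, hm'b, hzm, hmin⟩
    refine ⟨?_, hm'b⟩
    have hpz : phase z m' = (yl, 0) := by
      refine Prod.ext hzm (IsLocalMin.deriv_eq_zero ?_)
      filter_upwards [hz.isOpen.mem_nhds hmJ, Iic_mem_nhds hm'b] with x hx hxb
      rw [hzm]; exact hmin x hx hxb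
    by_contra! hle
    rcases hle.lt_or_eq with hlt | rfl
    · refine hz.not_mem_of_lt h hlt hmJ hm hpz hp hb hb0 ?_
      exact hz.ordConnected.out hmJ hbJ ⟨by linarith, by linarith⟩
    · obtain ⟨rfl, -⟩ := h.eq_of_phase_eq hz hm hmJ (hp.trans hpz.symm)
      exact hb.not_mem_of_isOpen h.isOpen hbJ
  · rintro ⟨hm', hm'b⟩
    obtain ⟨J, z, hz, hmJ, hpz⟩ := exists_isP1Solution m' (yl, 0)
    obtain ⟨hzm, hzd⟩ := Prod.ext_iff.1 hpz
    simp only [phase] at hzm hzd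
    have hbJ : b ∈ J := by
      by_contra hn
      obtain ⟨b', hb'b, hb'⟩ := exists_isLUB_of_not_mem hz.isConnected.isPreconnected hmJ hn hm'b
      have := hb'.lt_of_mem_isOpen hz.isOpen hmJ
      refine h.not_mem_of_lt hz hm' hm hmJ hp hpz hb' (hb'b.trans hb0) ?_
      exact hb.Ico_subset h.isConnected.isPreconnected hm ⟨by linarith, by linarith⟩
    refine ⟨z b, ?_, J, z, hz, hbJ, rfl, hmJ, hm'b, hzm, fun x hx hxb => ?_⟩
    · rw [gt_iff_lt, ← hzm]
      exact hz.lt_of_deriv_nonneg hmJ hbJ hb0 hm'b hzd.ge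
    · rcases eq_or_ne x m' with rfl | hne
      · exact hzm.ge
      · rw [← hzm]
        exact (hz.lt_of_critical hmJ (hm'b.le.trans hb0) hzd hx (hxb.trans hb0) hne).le

lemma IsP1Solution.isGLB_calXmin (h : IsP1Solution I y) {b m yl : ℝ} (hb0 : b ≤ 0)
    (hb : IsLUB I b) (hm : m ∈ I) (hp : phase y m = (yl, 0)) :
    IsGLB (xminValues b yl) (calXmin b yl) ∧ calXmin b yl = m := by
  have hmb : m < b := hb.lt_of_mem_isOpen h.isOpen hm
  rw [calXmin, h.xminValues_eq hb0 hb hm hp, csInf_Ioo hmb]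
  exact ⟨isGLB_Ioo hmb, rfl⟩

end minimum

/-! ### Continuous dependence and existence with a prescribed right end -/

/-- Continuous dependence on the initial data, with persistence of the solution. -/
lemma IsP1Solution.continuous_dependence {I : Set ℝ} {y : ℝ → ℝ} (h : IsP1Solution I y)
    {a p : ℝ} (hap : Icc a p ⊆ I) {η : ℝ} (hη : 0 < η) :
    ∃ δ > 0, ∀ (J : Set ℝ) (z : ℝ → ℝ) (m : ℝ), IsP1Solution J z → m ∈ J → m ∈ Icc a p →
      dist (phase z m) (phase y m) ≤ δ → p ∈ J ∧ dist (phase z p) (phase y p) ≤ η := by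
  obtain ⟨R₀, hR₀⟩ := isCompact_Icc.bddAbove_image
    ((h.solves.continuousOn_phase.mono hap).norm)
  set R : NNReal := ‖R₀‖₊ + 1 with hR
  have hyR : ∀ t ∈ Icc a p, ‖phase y t‖ ≤ R - 1 := fun t ht => by
    have := hR₀ (mem_image_of_mem _ ht)
    simp only [hR, NNReal.coe_add, coe_nnnorm, Real.norm_eq_abs, NNReal.coe_one]
    linarith [le_abs_self R₀]
  set K : NNReal := 12 * R + 1
  set ρ : ℝ := min 1 η with hρdef
  have hρ : 0 < ρ := lt_min one_pos hη
  have hρ1 : ρ ≤ 1 := min_le_left _ _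
  -- Grönwall's factor over the interval is at most `exp (K |p - a|)`, so the distance stays below
  -- `ρ / 2`, strictly inside the tube of radius `ρ` where the Lipschitz bound holds.
  refine ⟨ρ / 2 * Real.exp (-(K * |p - a|)), by positivity, ?_⟩
  intro J z m hz hmJ hm hdist
  set δ : ℝ := ρ / 2 * Real.exp (-(K * |p - a|)) with hδ
  have hδ0 : 0 ≤ δ := by positivity
  have hgrow : ∀ t ∈ Icc m p, δ * Real.exp (K * (t - m)) ≤ ρ / 2 := fun t ht => by
    rw [hδ, mul_assoc, ← Real.exp_add]
    have h1 : (K : ℝ) * (t - m) ≤ K * |p - a| := by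
      gcongr
      linarith [le_abs_self (p - a), ht.2, hm.1]
    have : Real.exp (-(K * |p - a|) + K * (t - m)) ≤ 1 := Real.exp_le_one_iff.2 (by linarith)
    nlinarith
  have hδρ : δ ≤ ρ / 2 := by simpa using hgrow m ⟨le_rfl, hm.2⟩
  have hmp : Icc m p ⊆ I := (Icc_subset_Icc_left hm.1).trans hap
  have hnorm : ∀ t ∈ Icc m p, dist (phase z t) (phase y t) ≤ ρ → ‖phase z t‖ ≤ R :=
    fun t ht hd => by
      have h1 := hyR t ⟨hm.1.trans ht.1, ht.2⟩
      have h2 := norm_le_norm_add_norm_sub' (phase z t) (phase y t)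
      rw [← dist_eq_norm] at h2
      linarith
  set S : Set ℝ := {t | t ∈ Icc m p ∧ ∀ s ∈ Icc m t, s ∈ J ∧ dist (phase z s) (phase y s) ≤ ρ}
  have hmS : m ∈ S := ⟨⟨le_rfl, hm.2⟩, fun s hs => by
    obtain rfl : s = m := by simpa using hs
    exact ⟨hmJ, by linarith⟩⟩
  have hSb : BddAbove S := ⟨p, fun t ht => ht.1.2⟩
  -- Continuity method: `z` cannot end at `τ` since it is bounded in the tube, and being strictly
  -- inside it can be followed further unless `τ = p`.
  set τ := sSup S with hτ
  have hmτ : m ≤ τ := le_csSup hSb hmS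
  have hτp : τ ≤ p := csSup_le ⟨m, hmS⟩ fun t ht => ht.1.2
  have hbelow : ∀ t ∈ Ico m τ, t ∈ J ∧ dist (phase z t) (phase y t) ≤ ρ := fun t ht => by
    obtain ⟨s, hs, hts⟩ := exists_lt_of_lt_csSup ⟨m, hmS⟩ ht.2
    exact hs.2 t ⟨ht.1, hts.le⟩
  have hτJ : τ ∈ J := by
    by_contra hn
    have hlt : m < τ := lt_of_le_of_ne hmτ fun e => hn (e ▸ hmJ)
    obtain ⟨t, ht, hlarge⟩ := hz.exists_large hn (S := Ico m τ) (fun t ht => (hbelow t ht).1)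
      (by rw [closure_Ico hlt.ne]; exact right_mem_Icc.2 hmτ) R
    have := hnorm t ⟨ht.1, ht.2.le.trans hτp⟩ (hbelow t ht).2
    linarith
  have hsubJ : Icc m τ ⊆ J := hz.ordConnected.out hmJ hτJ
  have hsubI : Icc m τ ⊆ I := (Icc_subset_Icc_right hτp).trans hmp
  have hfin : dist (phase z τ) (phase y τ) ≤ δ * Real.exp (K * (τ - m)) := by
    refine dist_le_of_trajectories_ODE_of_mem (v := p1Field)
      (s := fun _ => {Y : ℝ × ℝ | |Y.1| ≤ R}) (fun t _ => p1Field_lipschitzOnWith R t)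
      (hz.solves.continuousOn_phase.mono hsubJ)
      (fun t ht => (hz.solves.hasDerivAt_phase
        (hsubJ (Ico_subset_Icc_self ht))).hasDerivWithinAt) (fun t ht => ?_)
      (h.solves.continuousOn_phase.mono hsubI)
      (fun t ht => (h.solves.hasDerivAt_phase
        (hsubI (Ico_subset_Icc_self ht))).hasDerivWithinAt) (fun t ht => ?_)
      hdist τ (right_mem_Icc.2 hmτ)
    · exact (norm_fst_le (phase z t)).trans
        (hnorm t ⟨ht.1, ht.2.le.trans hτp⟩ (hbelow t ht).2)
    · exact (norm_fst_le (phase y t)).trans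
        ((hyR t ⟨hm.1.trans ht.1, ht.2.le.trans hτp⟩).trans (by linarith))
  have hfin' := hfin.trans (hgrow τ ⟨hmτ, hτp⟩)
  rcases hτp.lt_or_eq with hlt | heq
  · exfalso
    have hcz := (hz.solves.hasDerivAt_phase hτJ).continuousAt
    have hcy := (h.solves.hasDerivAt_phase (hsubI (right_mem_Icc.2 hmτ))).continuousAt
    have hev : ∀ᶠ t in 𝓝 τ, dist (phase z t) (phase y t) < ρ ∧ t ∈ J :=
      ((hcz.dist hcy).eventually_lt_const (by linarith)).and (hz.isOpen.mem_nhds hτJ)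
    obtain ⟨ε, hε, hball⟩ := Metric.eventually_nhds_iff.1 hev
    set τ' := min p (τ + ε / 2) with hτ'
    have hττ' : τ < τ' := lt_min hlt (by linarith)
    have : τ' ∈ S := by
      refine ⟨⟨hmτ.trans hττ'.le, min_le_left _ _⟩, fun s hs => ?_⟩
      rcases lt_or_ge s τ with hsτ | hsτ
      · exact hbelow s ⟨hs.1, hsτ⟩
      · have h2 : s ≤ τ + ε / 2 := hs.2.trans (min_le_right _ _)
        have := hball (y := s) (by rw [Real.dist_eq, abs_of_nonneg (by linarith)]; linarith)
        exact ⟨this.2, this.1.le⟩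
    exact absurd (le_csSup hSb this) (not_le.2 hττ')
  · rw [heq] at hτJ hfin'
    exact ⟨hτJ, hfin'.trans (by linarith [min_le_right (1 : ℝ) η])⟩

/-- Energy estimate to the right of a minimum. -/
lemma IsP1Solution.energy_le {I : Set ℝ} {y : ℝ → ℝ} (h : IsP1Solution I y) {m p yl : ℝ}
    (hm : m ∈ I) (hphase : phase y m = (yl, 0)) (hp : p ∈ I) (hp0 : p ≤ 0) (hmp : m ≤ p) :
    4 * y p ^ 3 - 4 * yl ^ 3 ≤ deriv y p ^ 2 := by
  obtain ⟨hy, hd⟩ := Prod.ext_iff.1 hphase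
  simp only [phase] at hy hd
  have hsub : Icc m p ⊆ I := h.ordConnected.out hm hp
  have := le_of_hasDerivAt_nonneg (g := fun t => deriv y t ^ 2 - 4 * y t ^ 3)
    (g' := fun t => 2 * deriv y t * (6 * y t ^ 2 - t) - 4 * (3 * y t ^ 2 * deriv y t)) hmp
    (fun s hs => by
      simpa using ((h.solves s (hsub hs)).2.fun_pow 2).fun_sub
        (((h.solves.hasDerivAt (hsub hs)).fun_pow 3).const_mul 4))
    (fun s hs => by
      have hs0 : s ≤ 0 := hs.2.trans hp0
      have : deriv y m ≤ deriv y s := h.strictMonoOn_deriv.monotoneOn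
        ⟨hm, hmp.trans hp0⟩ ⟨hsub hs, hs0⟩ hs.1
      have : 0 ≤ deriv y s * (-s) := mul_nonneg (by linarith) (by linarith)
      linarith)
  simp only [hy, hd] at this
  linarith

/-- Every nonpositive number is the right end of the interval of existence of a solution with
prescribed minimum value. -/
lemma exists_isP1Solution_isLUB {x₀ : ℝ} (hx₀ : x₀ ≤ 0) (yl : ℝ) :
    ∃ (I : Set ℝ) (y : ℝ → ℝ) (m : ℝ), IsP1Solution I y ∧ IsLUB I x₀ ∧ m ∈ I ∧
      phase y m = (yl, 0) := by
  choose I y hsol hmem hphase using fun m : ℝ => exists_isP1Solution m (yl, 0)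
  have hval : ∀ m, y m m = yl := fun m => congrArg Prod.fst (hphase m)
  have hder : ∀ m, deriv (y m) m = 0 := fun m => congrArg Prod.snd (hphase m)
  set B : Set ℝ := {m | m < x₀ ∧ x₀ ∉ I m}
  have hBb : BddAbove B := ⟨x₀, fun m hm => hm.1.le⟩
  have hBne : B.Nonempty := by
    set M : ℝ := 2 * (|yl| + 4)
    have hM : 0 < M := by positivity
    refine ⟨x₀ - M - 2, by linarith, fun hx => ?_⟩
    -- On `[m, m + 2]` one has `-t ≥ M`, and `M / 2 = |yl| + 4` is what the blow-up estimate needs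
    -- with `T = 1`.
    set m := x₀ - M - 2 with hm
    have hsub : Icc m (m + 1 + 1) ⊆ I m := fun t ht =>
      (hsol m).ordConnected.out (hmem m) hx ⟨ht.1, by linarith [ht.2]⟩
    refine no_long_convex_solution (z := y m) (z' := deriv (y m))
      (f := fun t => 6 * y m t ^ 2 - t) (a := m) (T := 1) (M := M) zero_le_one hM
      (fun t ht => (hsol m).solves.hasDerivAt (hsub ht))
      (fun t ht => ((hsol m).solves t (hsub ht)).2) (fun t ht => ?_) (fun t ht => ?_)
      (hder m).ge ?_
    · linarith [ht.2]
    · nlinarith [ht.2, sq_nonneg (y m t)]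
    · rw [hval]; linarith
  -- The critical minimum point: to its right all solutions reach `x₀`. It remains to exclude that
  -- the solution at `c` reaches `x₀`, and that it ends strictly earlier.
  set c := sSup B with hc
  have hcx : c ≤ x₀ := csSup_le hBne fun m hm => hm.1.le
  have hx₀c : x₀ ∉ I c := by
    intro hx
    obtain ⟨ε, hε, hball⟩ := Metric.isOpen_iff.1 (hsol c).isOpen c (hmem c)
    have ha : c - ε / 2 ∈ I c := hball (by rw [Real.ball_eq_Ioo]; constructor <;> linarith)
    obtain ⟨δ, hδ, hdep⟩ := (hsol c).continuous_dependence
      ((hsol c).ordConnected.out ha hx) one_pos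
    have hcont := ((hsol c).solves.hasDerivAt_phase (hmem c)).continuousAt
    obtain ⟨r, hr, hnear⟩ := Metric.continuousAt_iff.1 hcont δ hδ
    obtain ⟨m, hmB, hm⟩ := exists_lt_of_lt_csSup hBne
      (show c - min (ε / 2) r < c by linarith [lt_min (half_pos hε) hr])
    have hmc : m ≤ c := le_csSup hBb hmB
    refine hmB.2 (hdep (I m) (y m) m (hsol m) (hmem m)
      ⟨by linarith [min_le_left (ε / 2) r], hmB.1.le⟩ ?_).1
    rw [hphase m, ← hphase c, dist_comm]
    refine (hnear ?_).le
    rw [Real.dist_eq, abs_sub_lt_iff]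
    constructor <;> linarith [min_le_right (ε / 2) r]
  have hcx' : c < x₀ := lt_of_le_of_ne hcx fun e => hx₀c (e ▸ hmem c)
  obtain ⟨b, hbx, hb⟩ := exists_isLUB_of_not_mem (hsol c).isConnected.isPreconnected (hmem c)
    hx₀c hcx'
  have hb0 : b ≤ 0 := hbx.trans hx₀
  rcases hbx.lt_or_eq with hlt | rfl
  swap
  · exact ⟨I c, y c, c, hsol c, hb, hmem c, hphase c⟩
  exfalso
  set l := x₀ - b with hl
  have hl0 : 0 < l := by linarith
  -- The first summand makes the remaining lifespan `2/√y` at most `l`; the second lets the energy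
  -- estimate give `y³ < y'²`.
  set N : ℝ := (2 / l) ^ 2 + 2 * |yl| with hN
  have hN0 : 0 < N := by positivity
  have hcb : c < b := hb.lt_of_mem_isOpen (hsol c).isOpen (hmem c)
  obtain ⟨p, hp, hNp⟩ := (hsol c).unbounded_above hb hb0 (hmem c) N
  have hylN : |yl| ≤ N := by
    have := sq_nonneg (2 / l)
    linarith [abs_nonneg yl]
  have hcp : c < p := lt_of_le_of_ne hp.1 fun e => by
    rw [← e, hval] at hNp; linarith [le_abs_self yl]
  have hpI : p ∈ I c := hb.Ico_subset (hsol c).isConnected.isPreconnected (hmem c) hp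
  have hp0 : p ≤ 0 := hp.2.le.trans hb0
  have hderp : 0 < deriv (y c) p := by
    rw [← hder c]
    exact (hsol c).strictMonoOn_deriv ⟨hmem c, hcp.le.trans hp0⟩ ⟨hpI, hp0⟩ hcp
  have hen := (hsol c).energy_le (hmem c) (hphase c) hpI hp0 hcp.le
  have hcube : y c p ^ 3 < deriv (y c) p ^ 2 := by
    have h1 : 2 * |yl| ≤ y c p := by
      have := sq_nonneg (2 / l)
      linarith
    have h2 : (2 * |yl|) ^ 3 ≤ y c p ^ 3 := by gcongr
    have h3 : yl ^ 3 ≤ |yl| ^ 3 := by rw [← abs_pow]; exact le_abs_self _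
    have h4 : 0 < y c p ^ 3 := by
      have : 0 < y c p := hN0.trans hNp
      positivity
    nlinarith
  set U : Set (ℝ × ℝ) := {Y | N < Y.1 ∧ 0 < Y.2 ∧ Y.1 ^ 3 < Y.2 ^ 2}
  have hU : IsOpen U := by
    have o₁ : IsOpen {Y : ℝ × ℝ | N < Y.1} := isOpen_lt (by fun_prop) (by fun_prop)
    have o₂ : IsOpen {Y : ℝ × ℝ | 0 < Y.2} := isOpen_lt (by fun_prop) (by fun_prop)
    have o₃ : IsOpen {Y : ℝ × ℝ | Y.1 ^ 3 < Y.2 ^ 2} := isOpen_lt (by fun_prop) (by fun_prop)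
    exact o₁.inter (o₂.inter o₃)
  obtain ⟨η, hη, hηU⟩ := Metric.nhds_basis_closedBall.mem_iff.1
    (hU.mem_nhds (show phase (y c) p ∈ U from ⟨hNp, hderp, hcube⟩))
  obtain ⟨δ, hδ, hdep⟩ := (hsol c).continuous_dependence
    ((hsol c).ordConnected.out (hmem c) hpI) hη
  have hcont := ((hsol c).solves.hasDerivAt_phase (hmem c)).continuousAt
  obtain ⟨r, hr, hnear⟩ := Metric.continuousAt_iff.1 hcont δ hδ
  -- A minimum point slightly to the right of `c`: its solution should reach `x₀`, but at `p` it is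
  -- already in `U` and cannot last for time `l`.
  set m := c + min (p - c) (r / 2) with hm
  have hcm : c < m := by
    have : 0 < min (p - c) (r / 2) := lt_min (by linarith) (half_pos hr)
    linarith
  have hmp : m ≤ p := by linarith [min_le_left (p - c) (r / 2)]
  obtain ⟨hpm, hclose⟩ := hdep (I m) (y m) m (hsol m) (hmem m) ⟨hcm.le, hmp⟩ (by
    rw [hphase m, ← hphase c, dist_comm]
    refine (hnear ?_).le
    rw [Real.dist_eq, abs_sub_lt_iff]
    constructor <;> linarith [min_le_right (p - c) (r / 2)])
  obtain ⟨hz1, hz2, hz3⟩ := hηU (Metric.mem_closedBall.2 hclose)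
  simp only [phase] at hz1 hz2 hz3
  have hmx : m < x₀ := by linarith [hp.2]
  have hx₀m : x₀ ∈ I m := by
    by_contra hn
    exact absurd (le_csSup hBb (show m ∈ B from ⟨hmx, hn⟩)) (not_le.2 hcm)
  have hsub : Icc p (p + l) ⊆ I m := fun t ht =>
    (hsol m).ordConnected.out hpm hx₀m ⟨ht.1, by linarith [ht.2, hp.2]⟩
  have hlife := lifespan_lt (z := y m) (z' := deriv (y m)) (f := fun t => 6 * y m t ^ 2 - t)
    hl0.le (fun t ht => (hsol m).solves.hasDerivAt (hsub ht))
    (fun t ht => ((hsol m).solves t (hsub ht)).2)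
    (fun t ht => by linarith [ht.2, hp.2]) (hN0.trans hz1) hz2 hz3.le
  have hsq : 2 / l ≤ √(y m p) := Real.le_sqrt_of_sq_le (by linarith [abs_nonneg yl])
  have : (√(y m p))⁻¹ ≤ (2 / l)⁻¹ := inv_anti₀ (by positivity) hsq
  rw [inv_div] at this
  linarith

/-! ### Holomorphic differential equations -/

section holomorphic
open Metric

/-- Cauchy's existence theorem for holomorphic autonomous ordinary differential equations. -/
lemma exists_holomorphic_solution {E : Type*} [NormedAddCommGroup E] [NormedSpace ℂ E]
    [CompleteSpace E] {F : E → E} (hF : Differentiable ℂ F) {e₀ : E} {K : NNReal} {R : ℝ}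
    (hR : 0 < R) (hK : LipschitzOnWith K F (closedBall e₀ R)) (c : ℂ) :
    ∃ r > 0, ∃ f : ℂ → E, f c = e₀ ∧ ∀ z ∈ ball c r, HasDerivAt f (F (f z)) z := by
  set M : ℝ := ‖F e₀‖ + K * R + 1 with hM
  have hK0 : (0 : ℝ) ≤ K := K.2
  have hM0 : 0 < M := by positivity
  have hFM : ∀ e ∈ closedBall e₀ R, ‖F e‖ ≤ M := fun e he => by
    have h1 := hK.dist_le_mul e he e₀ (mem_closedBall_self hR.le)
    rw [dist_eq_norm] at h1
    have h2 : (K : ℝ) * dist e e₀ ≤ K * R := by gcongr; exact he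
    have h3 := norm_le_norm_add_norm_sub' (F e) (F e₀)
    linarith
  -- The first bound keeps the Picard iterates in the ball of radius `R`; the second makes the
  -- iteration contract by `1/2`.
  set r : ℝ := min (R / M) (1 / (2 * (K + 1))) with hr
  have hr0 : 0 < r := lt_min (by positivity) (by positivity)
  have hrM : M * r ≤ R := by
    have : r ≤ R / M := min_le_left _ _
    rwa [le_div_iff₀' hM0] at this
  have hrK : K * r ≤ 1 / 2 := by
    have : r ≤ 1 / (2 * (K + 1)) := min_le_right _ _
    rw [le_div_iff₀ (by positivity)] at this
    nlinarith
  have hc : c ∈ ball c r := mem_ball_self hr0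
  let X := {g : ℂ → E // DifferentiableOn ℂ g (ball c r) ∧ g c = e₀ ∧
    ∀ z ∈ ball c r, g z ∈ closedBall e₀ R}
  have step : ∀ g : X, ∃ g' : X, ∀ z ∈ ball c r, HasDerivAt g'.1 (F (g.1 z)) z := by
    intro g
    -- On a disc a holomorphic function has a primitive, which plays the role of the Picard
    -- integral.
    obtain ⟨g', h0, hd⟩ := ((hF.comp_differentiableOn g.2.1).isExactOn_ball).with_val_at c e₀
    refine ⟨⟨g', fun z hz => (hd z hz).differentiableAt.differentiableWithinAt, h0,
      fun z hz => ?_⟩, hd⟩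
    have := (convex_ball c r).norm_image_sub_le_of_norm_hasDerivWithin_le
      (fun x hx => (hd x hx).hasDerivWithinAt) (fun x hx => hFM _ (g.2.2.2 x hx)) hc hz
    rw [h0] at this
    rw [mem_closedBall, dist_eq_norm]
    refine this.trans (le_trans ?_ hrM)
    gcongr
    rw [← dist_eq_norm]; exact (mem_ball.1 hz).le
  choose T hT using step
  let g₀ : X := ⟨fun _ => e₀, differentiableOn_const _, rfl, fun _ _ => mem_closedBall_self hR.le⟩
  let g : ℕ → X := fun n => T^[n] g₀
  have hg : ∀ n, ∀ z ∈ ball c r, HasDerivAt (g (n + 1)).1 (F ((g n).1 z)) z := fun n z hz => by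
    have : g (n + 1) = T (g n) := Function.iterate_succ_apply' T n g₀
    rw [this]; exact hT _ z hz
  have hdist : ∀ n, ∀ z ∈ ball c r, dist ((g n).1 z) ((g (n + 1)).1 z) ≤ R * (1 / 2) ^ n := by
    intro n
    induction n with
    | zero =>
      intro z hz
      rw [dist_comm, pow_zero, mul_one]
      exact (g 1).2.2.2 z hz
    | succ n ih =>
      intro z hz
      have := (convex_ball c r).norm_image_sub_le_of_norm_hasDerivWithin_le
        (f := fun z => (g (n + 1)).1 z - (g (n + 2)).1 z) (C := K * (R * (1 / 2) ^ n))
        (fun x hx => ((hg n x hx).fun_sub (hg (n + 1) x hx)).hasDerivWithinAt)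
        (fun x hx => by
          rw [← dist_eq_norm]
          refine (hK.dist_le_mul _ ((g n).2.2.2 x hx) _ ((g (n + 1)).2.2.2 x hx)).trans ?_
          gcongr
          exact ih x hx) hc hz
      simp only [(g (n + 1)).2.2.1, (g (n + 2)).2.2.1, sub_self, sub_zero] at this
      rw [dist_eq_norm]
      refine this.trans ?_
      have h1 : ‖z - c‖ ≤ r := by rw [← dist_eq_norm]; exact (mem_ball.1 hz).le
      calc (K : ℝ) * (R * (1 / 2) ^ n) * ‖z - c‖ ≤ K * (R * (1 / 2) ^ n) * r := by gcongr
        _ = K * r * (R * (1 / 2) ^ n) := by ring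
        _ ≤ 1 / 2 * (R * (1 / 2) ^ n) := by gcongr
        _ = R * (1 / 2) ^ (n + 1) := by ring
  have hlim : ∀ z : ℂ, ∃ a : E, z ∈ ball c r → Tendsto (fun n => (g n).1 z) atTop (𝓝 a) :=
    fun z => by
      by_cases hz : z ∈ ball c r
      · obtain ⟨a, ha⟩ := cauchySeq_tendsto_of_complete
          (cauchySeq_of_le_geometric (1 / 2) R (by norm_num) fun n => hdist n z hz)
        exact ⟨a, fun _ => ha⟩
      · exact ⟨0, fun h => absurd h hz⟩
  choose f hf using hlim
  have hfR : ∀ z ∈ ball c r, f z ∈ closedBall e₀ R := fun z hz =>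
    isClosed_closedBall.mem_of_tendsto (hf z hz) (Eventually.of_forall fun n => (g n).2.2.2 z hz)
  have hdf : ∀ n, ∀ z ∈ ball c r, dist ((g n).1 z) (f z) ≤ R * (1 / 2) ^ n / (1 - 1 / 2) :=
    fun n z hz => dist_le_of_le_geometric_of_tendsto (1 / 2) R (by norm_num)
      (fun n => hdist n z hz) (hf z hz) n
  refine ⟨r, hr0, f, ?_, fun z hz => ?_⟩
  · refine tendsto_nhds_unique (hf c hc) ?_
    simp only [fun n => (g n).2.2.1]
    exact tendsto_const_nhds
  · refine hasDerivAt_of_tendstoLocallyUniformlyOn (l := atTop) (f := fun n => (g (n + 1)).1)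
      (f' := fun n z => F ((g n).1 z)) (g' := fun z => F (f z)) isOpen_ball ?_
      (Eventually.of_forall hg) (fun x hx => (hf x hx).comp (tendsto_add_atTop_nat 1)) hz
    refine TendstoUniformlyOn.tendstoLocallyUniformlyOn (Metric.tendstoUniformlyOn_iff.2 ?_)
    intro ε hε
    have h0 : Tendsto (fun n : ℕ => K * (R * (1 / 2) ^ n / (1 - 1 / 2))) atTop (𝓝 0) := by
      have := tendsto_pow_atTop_nhds_zero_of_lt_one (r := (1 / 2 : ℝ)) (by norm_num) (by norm_num)
      have := (((this.const_mul R).div_const (1 - 1 / 2)).const_mul (K : ℝ))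
      simpa using this
    filter_upwards [h0.eventually_lt_const hε] with n hn x hx
    refine lt_of_le_of_lt ?_ hn
    rw [dist_comm]
    refine (hK.dist_le_mul _ ((g n).2.2.2 x hx) _ (hfR x hx)).trans ?_
    gcongr
    exact hdf n x hx

end holomorphic

/-! ### Regularization at the pole -/

/-- The first Painlevé equation in coordinates that are regular at its poles: here `y = u⁻²`,
`y' = -2 u⁻³ + x u / 2 + u² / 2 + v u³`, and the independent variable `x` is adjoined to the
unknowns `(u, v)`. -/
noncomputable def poleField {k : Type*} [Field k] (X : k × k × k) : k × k × k :=
  let q := X.1 / 4 + X.2.1 / 4 + X.2.2 * X.2.1 ^ 2 / 2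
  (1, 1 - X.2.1 ^ 4 * q, X.2.1 * q * (3 * X.2.2 * X.2.1 ^ 2 + X.1 / 2 + X.2.1))

lemma differentiable_poleField : Differentiable ℂ (poleField (k := ℂ)) := by
  unfold poleField; fun_prop

/-- A solution of the regularized system that approaches a point of the polar line is the
restriction of an analytic function. -/
lemma exists_analyticAt_of_tendsto {u v : ℝ → ℝ} {s b v₀ : ℝ} (hsb : s < b)
    (hu : ∀ t ∈ Ico s b, HasDerivAt u (poleField (t, u t, v t)).2.1 t)
    (hv : ∀ t ∈ Ico s b, HasDerivAt v (poleField (t, u t, v t)).2.2 t)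
    (hu₀ : Tendsto u (𝓝[<] b) (𝓝 0)) (hv₀ : Tendsto v (𝓝[<] b) (𝓝 v₀)) :
    ∃ U : ℝ → ℝ, AnalyticAt ℝ U b ∧ U b = 0 ∧ u =ᶠ[𝓝[<] b] U := by
  set F := poleField (k := ℂ) with hFdef
  have hF : Differentiable ℂ F := differentiable_poleField
  set e₀ : ℂ × ℂ × ℂ := ((b : ℂ), 0, (v₀ : ℂ)) with he₀
  obtain ⟨K, N, hN, hKN⟩ := ContDiffAt.exists_lipschitzOnWith (𝕂 := ℂ) (f := F) (x := e₀)
    (by rw [hFdef]; unfold poleField; fun_prop)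
  obtain ⟨R, hR, hRN⟩ := Metric.nhds_basis_closedBall.mem_iff.1 hN
  have hK : LipschitzOnWith K F (Metric.closedBall e₀ R) := hKN.mono hRN
  obtain ⟨r, hr, f, hfb, hf⟩ := exists_holomorphic_solution hF hR hK (b : ℂ)
  have hbr : (b : ℂ) ∈ Metric.ball (b : ℂ) r := Metric.mem_ball_self hr
  have hfan : AnalyticAt ℂ f b :=
    DifferentiableOn.analyticAt (fun z hz => (hf z hz).differentiableAt.differentiableWithinAt)
      (Metric.ball_mem_nhds _ hr)
  set φ : ℝ → ℂ × ℂ × ℂ := fun t => f t with hφ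
  have hφd : ∀ t : ℝ, (t : ℂ) ∈ Metric.ball (b : ℂ) r → HasDerivAt φ (F (φ t)) t := fun t ht => by
    have h1 : HasDerivAt (fun t : ℝ => (t : ℂ)) 1 t := (hasDerivAt_id t).ofReal_comp
    simpa [Function.comp_def] using! (hf t ht).scomp t h1
  -- The real solution is completed at `b` by its limit `e₀`. It then has a left derivative there,
  -- so uniqueness backwards from `b` identifies it with the holomorphic solution.
  set ψ : ℝ → ℂ × ℂ × ℂ := fun t => if t < b then ((t : ℂ), (u t : ℂ), (v t : ℂ)) else e₀ with hψ
  have hψlt : ∀ t, t < b → ψ t = ((t : ℂ), (u t : ℂ), (v t : ℂ)) := fun t ht => if_pos ht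
  have hψb : ψ b = e₀ := if_neg (lt_irrefl b)
  have hψd : ∀ t ∈ Ioo s b, HasDerivAt ψ (F (ψ t)) t := fun t ht => by
    have ht' : t ∈ Ico s b := Ioo_subset_Ico_self ht
    have h1 : HasDerivAt (fun t : ℝ => ((t : ℂ), (u t : ℂ), (v t : ℂ)))
        (F ((t : ℂ), (u t : ℂ), (v t : ℂ))) t := by
      have h2 := (hasDerivAt_id t).ofReal_comp.prodMk
        ((hu t ht').ofReal_comp.prodMk (hv t ht').ofReal_comp)
      convert! h2 using 1
      simp [F, poleField]
    rw [hψlt t ht.2]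
    refine h1.congr_of_eventuallyEq ?_
    filter_upwards [Iio_mem_nhds ht.2] with x hx using hψlt x hx
  have hψtend : Tendsto ψ (𝓝[<] b) (𝓝 e₀) := by
    have h1 : Tendsto (fun t : ℝ => ((t : ℂ), (u t : ℂ), (v t : ℂ))) (𝓝[<] b) (𝓝 e₀) := by
      refine Tendsto.prodMk_nhds ?_ (Tendsto.prodMk_nhds ?_ ?_)
      · exact (Complex.continuous_ofReal.tendsto b).mono_left nhdsWithin_le_nhds
      · simpa [Function.comp_def] using! (Complex.continuous_ofReal.tendsto 0).comp hu₀
      · exact (Complex.continuous_ofReal.tendsto v₀).comp hv₀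
    refine h1.congr' ?_
    filter_upwards [self_mem_nhdsWithin] with t ht using (hψlt t ht).symm
  have hψcont : ContinuousWithinAt ψ (Iic b) b := by
    rw [← Iio_insert, continuousWithinAt_insert_self, ContinuousWithinAt, hψb]
    exact hψtend
  have hmem : Ioo s b ∈ 𝓝[<] b := Ioo_mem_nhdsLT hsb
  have hψdb : HasDerivWithinAt ψ (F (ψ b)) (Iic b) b := by
    refine hasDerivWithinAt_Iic_of_tendsto_deriv (s := Ioo s b)
      (fun t ht => (hψd t ht).differentiableAt.differentiableWithinAt)
      (hψcont.mono fun t ht => ht.2.le) hmem ?_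
    have h1 : Tendsto (fun t => F (ψ t)) (𝓝[<] b) (𝓝 (F (ψ b))) := by
      rw [hψb]; exact (hF.continuous.tendsto e₀).comp hψtend
    refine h1.congr' ?_
    filter_upwards [hmem] with t ht using (hψd t ht).deriv.symm
  have hφb : φ b = e₀ := hfb
  have hφcont : ContinuousAt φ b := (hφd b hbr).continuousAt
  have hball : ∀ᶠ t : ℝ in 𝓝[<] b, (t : ℂ) ∈ Metric.ball (b : ℂ) r ∧ φ t ∈ Metric.closedBall e₀ R ∧
      ψ t ∈ Metric.closedBall e₀ R ∧ t ∈ Ioo s b := by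
    have a1 : ∀ᶠ t : ℝ in 𝓝[<] b, (t : ℂ) ∈ Metric.ball (b : ℂ) r :=
      nhdsWithin_le_nhds (Complex.continuous_ofReal.continuousAt.eventually_mem
        (Metric.isOpen_ball.mem_nhds hbr))
    have a2 : ∀ᶠ t : ℝ in 𝓝[<] b, φ t ∈ Metric.closedBall e₀ R :=
      nhdsWithin_le_nhds (hφcont.eventually_mem (by
        rw [hφb]; exact Metric.closedBall_mem_nhds _ hR))
    have a3 : ∀ᶠ t : ℝ in 𝓝[<] b, ψ t ∈ Metric.closedBall e₀ R :=
      hψtend.eventually (Metric.closedBall_mem_nhds _ hR)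
    filter_upwards [a1, a2, a3, hmem] with t b1 b2 b3 b4 using ⟨b1, b2, b3, b4⟩
  obtain ⟨l, hl, hlsub⟩ := (mem_nhdsLT_iff_exists_Ico_subset).1 hball
  have hlb : l < b := hl
  have hcases : ∀ t ∈ Icc l b, t = b ∨ t ∈ Ico l b := fun t ht =>
    ht.2.eq_or_lt.imp id fun h => ⟨ht.1, h⟩
  have hφmem : ∀ t ∈ Icc l b, (t : ℂ) ∈ Metric.ball (b : ℂ) r := fun t ht => by
    rcases hcases t ht with rfl | h
    · exact hbr
    · exact (hlsub h).1
  have hψwithin : ∀ t ∈ Icc l b, HasDerivWithinAt ψ (F (ψ t)) (Iic t) t := fun t ht => by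
    rcases hcases t ht with rfl | h
    · exact hψdb
    · exact (hψd t (hlsub h).2.2.2).hasDerivWithinAt
  have heq : EqOn φ ψ (Icc l b) := by
    refine ODE_solution_unique_of_mem_Icc_left (v := fun _ => F)
      (s := fun _ => Metric.closedBall e₀ R) (fun _ _ => hK)
      (fun t ht => (hφd t (hφmem t ht)).continuousAt.continuousWithinAt)
      (fun t ht => (hφd t (hφmem t (Ioc_subset_Icc_self ht))).hasDerivWithinAt)
      (fun t ht => ?_) (fun t ht => ?_)
      (fun t ht => hψwithin t (Ioc_subset_Icc_self ht)) (fun t ht => ?_) (hφb.trans hψb.symm)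
    · rcases hcases t (Ioc_subset_Icc_self ht) with rfl | h
      · rw [hφb]; exact Metric.mem_closedBall_self hR.le
      · exact (hlsub h).2.1
    · rcases hcases t ht with rfl | h
      · exact hψcont.mono fun x hx => hx.2
      · exact (hψd t (hlsub h).2.2.2).continuousAt.continuousWithinAt
    · rcases hcases t (Ioc_subset_Icc_self ht) with rfl | h
      · rw [hψb]; exact Metric.mem_closedBall_self hR.le
      · exact (hlsub h).2.2.1
  refine ⟨fun t => (φ t).2.1.re, ?_, ?_, ?_⟩
  · have h1 : AnalyticAt ℝ φ b :=
      hfan.restrictScalars (𝕜 := ℝ) |>.comp (Complex.ofRealCLM.analyticAt b)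
    exact ((Complex.reCLM.comp ((ContinuousLinearMap.fst ℝ ℂ ℂ).comp
      (ContinuousLinearMap.snd ℝ ℂ (ℂ × ℂ)))).analyticAt _).comp h1
  · simp [hφb, he₀]
  · filter_upwards [Ico_mem_nhdsLT hlb] with t ht
    rw [heq (Ico_subset_Icc_self ht), hψlt t ht.2, Complex.ofReal_re]

/-- A function whose derivative grows at most linearly in it has a limit at the end of a bounded
interval. -/
lemma exists_tendsto_of_linear_growth {v v' : ℝ → ℝ} {s b A B : ℝ} (hsb : s < b) (hA : 0 ≤ A)
    (hB : 0 ≤ B) (hv : ∀ t ∈ Ico s b, HasDerivAt v (v' t) t)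
    (hbound : ∀ t ∈ Ico s b, |v' t| ≤ A * |v t| + B) :
    ∃ v₀, Tendsto v (𝓝[<] b) (𝓝 v₀) := by
  set V := gronwallBound |v s| A B (b - s)
  have hV : ∀ t ∈ Ico s b, |v t| ≤ V := fun t ht => by
    have hsub : Icc s t ⊆ Ico s b := fun x hx => ⟨hx.1, hx.2.trans_lt ht.2⟩
    have := norm_le_gronwallBound_of_norm_deriv_right_le (f := v) (f' := v') (δ := |v s|) (K := A)
      (ε := B) (fun x hx => (hv x (hsub hx)).continuousAt.continuousWithinAt)
      (fun x hx => (hv x (hsub (Ico_subset_Icc_self hx))).hasDerivWithinAt) le_rfl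
      (fun x hx => hbound x (hsub (Ico_subset_Icc_self hx))) t (right_mem_Icc.2 ht.1)
    exact this.trans (gronwallBound_mono (abs_nonneg _) hB hA (by linarith [ht.2]))
  have hV0 : 0 ≤ V := (abs_nonneg _).trans (hV s ⟨le_rfl, hsb⟩)
  -- Grönwall has bounded `v`, hence `v'`; a Lipschitz function extends continuously to `b`.
  have hlip : LipschitzOnWith (A * V + B).toNNReal v (Ico s b) := by
    refine (convex_Ico s b).lipschitzOnWith_of_nnnorm_hasDerivWithin_le
      (fun x hx => (hv x hx).hasDerivWithinAt) fun x hx => ?_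
    rw [← NNReal.coe_le_coe, coe_nnnorm, Real.coe_toNNReal _ (by positivity)]
    refine (hbound x hx).trans ?_
    gcongr
    exact hV x hx
  obtain ⟨g, hg, hvg⟩ := hlip.extend_real
  refine ⟨g b, ((hg.continuous.tendsto b).mono_left nhdsWithin_le_nhds).congr' ?_⟩
  filter_upwards [Ico_mem_nhdsLT hsb] with t ht using (hvg ht).symm

/-- The first Painlevé equation in the coordinates `(u, v)`, expressed through `σ = √y` and
`w = y'`. -/
lemma hasDerivAt_poleField {σ w : ℝ → ℝ} {t : ℝ} (hσ : HasDerivAt σ (w t / (2 * σ t)) t)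
    (hw : HasDerivAt w (6 * (σ t ^ 2) ^ 2 - t) t) (h0 : σ t ≠ 0) :
    let u : ℝ → ℝ := fun s => -(σ s)⁻¹
    let v : ℝ → ℝ := fun s => 2 * σ s ^ 6 - s * σ s ^ 2 / 2 + σ s / 2 - σ s ^ 3 * w s
    HasDerivAt u (poleField (t, u t, v t)).2.1 t ∧
      HasDerivAt v (poleField (t, u t, v t)).2.2 t := by
  intro u v
  constructor
  · have := (hσ.fun_inv h0).fun_neg
    convert! this using 1
    simp only [poleField, u, v]
    field_simp
    ring
  · have := ((((hσ.fun_pow 6).const_mul 2).fun_sub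
      (((hasDerivAt_id' t).fun_mul (hσ.fun_pow 2)).div_const 2)).fun_add
      (hσ.div_const 2)).fun_sub ((hσ.fun_pow 3).fun_mul hw)
    convert! this using 1
    simp only [poleField, u, v]
    push_cast
    field_simp
    ring

lemma isRightPole_of_analyticAt {I : Set ℝ} {y U : ℝ → ℝ} {b : ℝ} (hb : IsLUB I b)
    (hU : AnalyticAt ℝ U b) (hU0 : U b = 0) (hy : Tendsto y (𝓝[<] b) atTop)
    (hyU : y =ᶠ[𝓝[<] b] fun t => (U t ^ 2)⁻¹) : IsRightPole I y b := by
  have hmer : MeromorphicAt (fun t => U t ^ 2) b := (hU.fun_pow 2).meromorphicAt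
  refine ⟨hb, (fun t => U t ^ 2)⁻¹, hmer.inv, ?_, hyU⟩
  rw [meromorphicOrderAt_inv]
  have hpos : 0 < meromorphicOrderAt (fun t => U t ^ 2) b := by
    rw [← tendsto_zero_iff_meromorphicOrderAt_pos hmer]
    have : Tendsto (fun t => U t ^ 2) (𝓝 b) (𝓝 (U b ^ 2)) := hU.continuousAt.tendsto.pow 2
    rw [hU0] at this
    simpa using this.mono_left nhdsWithin_le_nhds
  -- If `U²` vanished identically near `b`, then `y` would be `0⁻¹ = 0` to the left of `b`, against
  -- `y → +∞`.
  have hne : meromorphicOrderAt (fun t => U t ^ 2) b ≠ ⊤ := by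
    rw [Ne, meromorphicOrderAt_eq_top_iff]
    intro hz
    have h1 : ∀ᶠ t in 𝓝[<] b, U t ^ 2 = 0 :=
      hz.filter_mono (nhdsWithin_mono b fun t ht => ne_of_lt ht)
    obtain ⟨t, h2, h3, h4⟩ := (h1.and (hyU.and (hy.eventually_gt_atTop 0))).exists
    simp [h3, h2] at h4
  lift meromorphicOrderAt (fun t => U t ^ 2) b to ℤ using hne with n
  have hn : 0 < n := by exact_mod_cast hpos
  have : ((-n : ℤ) : WithTop ℤ) < 0 := by exact_mod_cast (by omega : -n < 0)
  simpa using! this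

/-- A solution has a pole at a nonpositive right end of its interval of existence. -/
lemma IsP1Solution.isRightPole {I : Set ℝ} {y : ℝ → ℝ} (h : IsP1Solution I y) {b : ℝ}
    (hb : IsLUB I b) (hb0 : b ≤ 0) : IsRightPole I y b := by
  have hlim := h.tendsto_atTop hb hb0
  obtain ⟨c, hc, hcpos⟩ := h.exists_deriv_pos hb hb0
  have hcb : c < b := hb.lt_of_mem_isOpen h.isOpen hc
  obtain ⟨s', hs', hs'sub⟩ := (mem_nhdsLT_iff_exists_Ico_subset).1 (hlim.eventually_ge_atTop 1)
  set s := max c s'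
  have hsb : s < b := max_lt hcb hs'
  have hcs : c ≤ s := le_max_left _ _
  have hI : Ico c b ⊆ I := hb.Ico_subset h.isConnected.isPreconnected hc
  have hsI : Ico s b ⊆ I := (Ico_subset_Ico_left hcs).trans hI
  have hy1 : ∀ t ∈ Ico s b, 1 ≤ y t := fun t ht => hs'sub ⟨(le_max_right _ _).trans ht.1, ht.2⟩
  set w := deriv y with hw
  have hw0 : ∀ t ∈ Ico s b, 0 ≤ w t := fun t ht => hcpos.le.trans
    (h.strictMonoOn_deriv.monotoneOn ⟨hc, hcb.le.trans hb0⟩ ⟨hsI ht, ht.2.le.trans hb0⟩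
      (hcs.trans ht.1))
  set σ : ℝ → ℝ := fun t => √(y t) with hσdef
  have hσ1 : ∀ t ∈ Ico s b, 1 ≤ σ t := fun t ht => Real.one_le_sqrt.2 (hy1 t ht)
  have hσy : ∀ t ∈ Ico s b, σ t ^ 2 = y t := fun t ht =>
    Real.sq_sqrt (zero_le_one.trans (hy1 t ht))
  have hσd : ∀ t ∈ Ico s b, HasDerivAt σ (w t / (2 * σ t)) t := fun t ht =>
    (h.solves.hasDerivAt (hsI ht)).sqrt (by linarith [hy1 t ht])
  have hreg := fun t (ht : t ∈ Ico s b) => hasDerivAt_poleField (hσd t ht)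
    (by rw [hσy t ht]; exact (h.solves t (hsI ht)).2) (by linarith [hσ1 t ht])
  set u : ℝ → ℝ := fun s => -(σ s)⁻¹ with hu
  set v : ℝ → ℝ := fun s => 2 * σ s ^ 6 - s * σ s ^ 2 / 2 + σ s / 2 - σ s ^ 3 * w s with hv
  -- This is the auxiliary `q` of `poleField` in terms of `σ` and `w`; its boundedness is what makes
  -- `v'` at most linear in `v`.
  set q : ℝ → ℝ := fun t => σ t ^ 4 - σ t * w t / 2 with hq
  -- the energy is of the order of `y`
  set E : ℝ → ℝ := fun t => w t ^ 2 / 2 - 2 * y t ^ 3 + t * y t with hE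
  have hEd : ∀ t ∈ Ico s b, HasDerivAt E (y t) t := fun t ht => by
    have hyd := h.solves.hasDerivAt (hsI ht)
    have := ((((h.solves t (hsI ht)).2.fun_pow 2).div_const 2).fun_sub
      ((hyd.fun_pow 3).const_mul 2)).fun_add ((hasDerivAt_id' t).fun_mul hyd)
    convert! this using 1
    push_cast; ring
  set C : ℝ := |E s| + (b - s) with hC
  have hEb : ∀ t ∈ Ico s b, |E t| ≤ C * y t := fun t ht => by
    have hsub : Icc s t ⊆ Ico s b := fun x hx => ⟨hx.1, hx.2.trans_lt ht.2⟩
    have h1 := le_of_hasDerivAt_nonneg ht.1 (fun x hx => hEd x (hsub hx))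
      (fun x hx => zero_le_one.trans (hy1 x (hsub hx)))
    have h2 := le_of_hasDerivAt_nonneg (g := fun t => y t * (t - s) - E t)
      (g' := fun t => w t * (t - s) + y t * 1 - y t) ht.1
      (fun x hx => ((h.solves.hasDerivAt (hsI (hsub hx))).fun_mul
        ((hasDerivAt_id' x).sub_const s)).fun_sub (hEd x (hsub hx)))
      (fun x hx => by
        have := mul_nonneg (hw0 x (hsub hx)) (sub_nonneg.2 hx.1)
        linarith)
    simp only [sub_self, mul_zero, zero_sub] at h2
    have h3 : y t * (t - s) ≤ y t * (b - s) := by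
      have := hy1 t ht
      gcongr; exact ht.2.le
    have h4 : |E s| ≤ |E s| * y t := le_mul_of_one_le_right (abs_nonneg _) (hy1 t ht)
    have h5 : 0 ≤ y t * (b - s) := mul_nonneg (by linarith [hy1 t ht]) (by linarith)
    rw [abs_le, hC]
    constructor <;> linarith [neg_abs_le (E s), le_abs_self (E s)]
  have hC0 : 0 ≤ C := add_nonneg (abs_nonneg _) (by linarith)
  have hts : ∀ t ∈ Ico s b, |t| ≤ |s| := fun t ht => by
    rw [abs_of_nonpos (by linarith [ht.2]), abs_of_nonpos (by linarith)]; linarith [ht.1]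
  set Q : ℝ := C + |s| with hQ
  have hQ0 : 0 ≤ Q := by positivity
  have hqb : ∀ t ∈ Ico s b, |q t| ≤ Q := fun t ht => by
    have hσ := hσ1 t ht
    have hσ0 : 0 < σ t := by linarith
    -- Factor `2σ⁶ - w²/2 = (2σ³ - w)(2σ³ + w)/2`: the small factor gives `q`, and the other is at
    -- least `2σ³` because `w ≥ 0`.
    have h1 : σ t * (t * σ t ^ 2 - E t) = q t * (w t + 2 * σ t ^ 3) := by
      simp only [hq, hE, ← hσy t ht]; ring
    have h2 : |t * σ t ^ 2 - E t| ≤ Q * σ t ^ 2 := by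
      refine (abs_sub _ _).trans ?_
      rw [abs_mul, abs_of_nonneg (sq_nonneg (σ t)), hQ]
      have h3 := hEb t ht
      rw [← hσy t ht] at h3
      have h4 : |t| * σ t ^ 2 ≤ |s| * σ t ^ 2 :=
        mul_le_mul_of_nonneg_right (hts t ht) (sq_nonneg _)
      linarith
    have h3 : |q t| * (w t + 2 * σ t ^ 3) ≤ Q * σ t ^ 3 := by
      have h4 : 0 ≤ w t + 2 * σ t ^ 3 := by have := hw0 t ht; positivity
      rw [← abs_of_nonneg h4, ← abs_mul, ← h1, abs_mul, abs_of_pos hσ0]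
      calc σ t * |t * σ t ^ 2 - E t| ≤ σ t * (Q * σ t ^ 2) := by gcongr
        _ = Q * σ t ^ 3 := by ring
    have h5 : |q t| * σ t ^ 3 ≤ |q t| * (w t + 2 * σ t ^ 3) := by
      have := hw0 t ht
      have : 0 ≤ σ t ^ 3 := by positivity
      gcongr; linarith
    exact le_of_mul_le_mul_right (h5.trans h3) (by positivity)
  have hv' : ∀ t ∈ Ico s b, (poleField (t, u t, v t)).2.2 =
      u t * q t * (3 * v t * u t ^ 2 + t / 2 + u t) := fun t ht => by
    have : σ t ≠ 0 := by linarith [hσ1 t ht]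
    simp only [poleField]
    congr 2
    simp only [hu, hv, hq]
    field_simp
    ring
  have hu1 : ∀ t ∈ Ico s b, |u t| ≤ 1 := fun t ht => by
    rw [hu, abs_neg, abs_inv, abs_of_pos (by linarith [hσ1 t ht])]
    exact inv_le_one_of_one_le₀ (hσ1 t ht)
  obtain ⟨v₀, hv₀⟩ : ∃ v₀, Tendsto v (𝓝[<] b) (𝓝 v₀) := by
    refine exists_tendsto_of_linear_growth (A := 3 * Q) (B := Q * (|s| / 2 + 1)) hsb
      (by positivity) (by positivity) (fun t ht => (hreg t ht).2) fun t ht => ?_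
    rw [hv' t ht, abs_mul, abs_mul]
    have h1 := hu1 t ht
    have h2 : |3 * v t * u t ^ 2 + t / 2 + u t| ≤ 3 * |v t| + |s| / 2 + 1 := by
      refine (abs_add_three _ _ _).trans ?_
      rw [abs_mul, abs_mul, abs_pow, abs_div, abs_of_pos (by norm_num : (0 : ℝ) < 3),
        abs_of_pos (by norm_num : (0 : ℝ) < 2)]
      have h3 : |u t| ^ 2 ≤ 1 := pow_le_one₀ (abs_nonneg _) h1
      have h4 : 3 * |v t| * |u t| ^ 2 ≤ 3 * |v t| * 1 := by gcongr
      linarith [hts t ht]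
    calc |u t| * |q t| * |3 * v t * u t ^ 2 + t / 2 + u t|
        ≤ 1 * Q * (3 * |v t| + |s| / 2 + 1) := by
          gcongr
          exact hqb t ht
      _ = 3 * Q * |v t| + Q * (|s| / 2 + 1) := by ring
  have hu₀ : Tendsto u (𝓝[<] b) (𝓝 0) := by
    simpa [hu] using (tendsto_inv_atTop_zero.comp (Real.tendsto_sqrt_atTop.comp hlim)).neg
  obtain ⟨U, hU, hU0, huU⟩ := exists_analyticAt_of_tendsto hsb (fun t ht => (hreg t ht).1)
    (fun t ht => (hreg t ht).2) hu₀ hv₀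
  refine isRightPole_of_analyticAt hb hU hU0 hlim ?_
  filter_upwards [huU, Ico_mem_nhdsLT hsb] with t ht hts
  rw [← ht, ← hσy t hts]
  simp [hu]

theorem theorem3p1 :
    -- every solution living on the nonpositive semi-axis has a right pole and a minimum value
    (∀ (I : Set ℝ) (y : ℝ → ℝ), IsP1Solution I y → I ⊆ Iic 0 →
      ∃ x₀ yl : ℝ, x₀ ≤ 0 ∧ IsRightPole I y x₀ ∧ IsLeast (y '' I) yl) ∧
    -- all pairs of a right pole and a minimum value occur
    (∀ x₀ yl : ℝ, x₀ ≤ 0 →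
      ∃ (I : Set ℝ) (y : ℝ → ℝ), IsP1Solution I y ∧ I ⊆ Iic 0 ∧
        IsRightPole I y x₀ ∧ IsLeast (y '' I) yl) ∧
    -- the right pole and the minimum value determine the solution
    (∀ (x₀ yl : ℝ) (I₁ I₂ : Set ℝ) (y₁ y₂ : ℝ → ℝ),
      IsP1Solution I₁ y₁ → I₁ ⊆ Iic 0 → IsRightPole I₁ y₁ x₀ → IsLeast (y₁ '' I₁) yl →
      IsP1Solution I₂ y₂ → I₂ ⊆ Iic 0 → IsRightPole I₂ y₂ x₀ → IsLeast (y₂ '' I₂) yl →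
      I₁ = I₂ ∧ EqOn y₁ y₂ I₁) ∧
    -- the minimum value is attained exactly at `𝒳_min(x₀, y_l)`, which is a genuine infimum
    (∀ (x₀ yl : ℝ) (I : Set ℝ) (y : ℝ → ℝ),
      IsP1Solution I y → I ⊆ Iic 0 → IsRightPole I y x₀ → IsLeast (y '' I) yl →
      IsGLB (xminValues x₀ yl) (calXmin x₀ yl) ∧
        {x | x ∈ I ∧ y x = yl} = {calXmin x₀ yl}) := by
  refine ⟨fun I y h hI => ?_, fun x₀ yl hx₀ => ?_, ?_, ?_⟩
  · obtain ⟨b, m, hb0, hb, hm, hd⟩ := h.exists_critical hI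
    exact ⟨b, y m, hb0, h.isRightPole hb hb0, h.isLeast_of_critical hI hm (Prod.ext rfl hd)⟩
  · obtain ⟨I, y, m, h, hb, hm, hp⟩ := exists_isP1Solution_isLUB hx₀ yl
    have hI : I ⊆ Iic 0 := fun x hx => (hb.1 hx).trans hx₀
    exact ⟨I, y, h, hI, h.isRightPole hb hx₀, h.isLeast_of_critical hI hm hp⟩
  · intro x₀ yl I₁ I₂ y₁ y₂ h₁ hI₁ hb₁ hl₁ h₂ _ hb₂ hl₂
    obtain ⟨m₁, hm₁, hp₁⟩ := h₁.phase_of_isLeast hl₁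
    obtain ⟨m₂, hm₂, hp₂⟩ := h₂.phase_of_isLeast hl₂
    exact h₁.unique_of_isLUB h₂ (hb₁.1.2 hI₁) hb₁.1 hb₂.1 hm₁ hm₂ hp₁ hp₂
  · intro x₀ yl I y h hI hb hl
    obtain ⟨m, hm, hp⟩ := h.phase_of_isLeast hl
    obtain ⟨hglb, heq⟩ := h.isGLB_calXmin (hb.1.2 hI) hb.1 hm hp
    exact ⟨hglb, by rw [heq]; exact h.setOf_eq_singleton hI hm hp⟩
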